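/- Let $\mathcal T$ be a conforming mesh of finitely many closed non-degenerate tetrahedra in $\mathbb R^3$, let $\Omega=\operatorname{int}\bigcup_{K\in\mathcal T}K$, and let $k\ge 1$. Let $S_{k,0}(\mathcal T)$ be the space of continuous functions that are polynomials of degree at most $k$ on each $K\in\mathcal T$ and vanish on $\partial\Omega$, and put $\mathbf S_{k,0}(\mathcal T)=S_{k,0}(\mathcal T)^3$. Let $\mathbb P_{k-1}(\mathcal T)\subset L^2(\Omega)$ be the space of functions that are polynomials of degree at most $k-1$ on each open tetrahedron, and let $\mathbb P_{k-1,0}(\mathcal T)$ be its subspace of functions with $\int_\Omega p=0$. The pair $(\mathbf S_{k,0}(\mathcal T),\mathbb P_{k-1,0}(\mathcal T))$ is inf-sup stable if there is $\gamma>0$ with $$\inf_{p\in\mathbb P_{k-1,0}(\mathcal T)\setminus\{0\}}\ \sup_{\mathbf v\in\mathbf S_{k,0}(\mathcal T)\setminus\{0\}}\frac{(p,\operatorname{div}\mathbf v)_{L^2(\Omega)}}{\|\nabla\mathbf v\|_{L^2(\Omega)}\,\|p\|_{L^2(\Omega)}}\ \ge\ \gamma .$$ An edge of $\mathcal T$ is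 a boundary edge if it is contained in $\partial\Omega$, and an inner edge otherwise. An edge $E$ is critical if all triangular facets of $\mathcal T$ that contain $E$ lie in at most two planes. Write $\mathcal T_E$ for the set of tetrahedra containing $E$. For a vertex $\mathbf p$ of a tetrahedron $K$, $\lambda_{K,\mathbf p}$ is the affine function with value $1$ at $\mathbf p$ and $0$ at the other vertices of $K$. $P^{(0,3)}_{n}$ is the Jacobi polynomial of degree $n$ with parameters $(0,3)$. Let $E$ be a critical edge. 1. If $E$ is an inner edge, then $\mathcal T_E$ consists of exactly four tetrahedra. They can be numbered $K_1,\dots,K_4$ cyclically so that $K_i$ and $K_{i+1}$ share a facet $F_i$ (with $K_5=K_1$), where $F_1,F_3$ lie in one plane and $F_2,F_4$ lie in another plane. If $E$ is a boundary edge, then $\mathcal T_E$ consists of $n\in\{1,2,3\}$ tetrahedra, and if $n=3$ they can be numbered so that consecutive ones share a facet. 2. Let $K_1,\dots,K_n$ be any numbering of $\mathcal T_E$ in which, if $n\ge 3$, consecutive tetrahedra share a facet, and let $\mathbf p$ be an endpoint of $E$. Then the function $$p^{E,\mathbf p}_{k-1}=\sum_{i=1}^{n}\frac{(-1)^i}{|K_i|}\,\chi_{K_i}\,P^{(0,3)}_{k-1}\bigl(1-2\lambda_{K_i,\mathbf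 p}\bigr)$$ belongs to $\mathbb P_{k-1}(\mathcal T)$ and satisfies $$\bigl(p^{E,\mathbf p}_{k-1},\operatorname{div}\mathbf v\bigr)_{L^2(\Omega)}=0\qquad\text{for all }\mathbf v\in\mathbf S_{k,0}(\mathcal T).$$ If $E$ is an inner edge, or if $n=2$, then $p^{E,\mathbf p}_{k-1}$ is moreover a critical pressure, that is, a non-zero element of $\mathbb P_{k-1,0}(\mathcal T)$ with this orthogonality. 3. Consequently, if $E$ is an inner edge, then the pair $(\mathbf S_{k,0}(\mathcal T),\mathbb P_{k-1,0}(\mathcal T))$ is not inf-sup stable. The same holds if $E$ is a boundary edge, unless $k=1$ and $\mathcal T$ consists of a single tetrahedron. -/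

import Mathlib

open MeasureTheory

noncomputable section

/-- Euclidean three-space. -/
abbrev E3 : Type := EuclideanSpace ℝ (Fin 3)

/-! ### Conforming tetrahedral meshes

A simplex is represented by the finite set of its vertices; the closed simplex itself is the convex
hull of that set.  `Geometry.SimplicialComplex` says that all simplices are non-degenerate and that
any two of them meet in the convex hull of their common vertices. -/

/-- A conforming finite element mesh of closed tetrahedra: a finite simplicial complex in `ℝ³`
in which every simplex is a face of a tetrahedron. -/
def IsTetMesh (T : Geometry.SimplicialComplex ℝ E3) : Prop :=
  T.faces.Finite ∧ ∀ s ∈ T.faces, ∃ t ∈ T.faces, s ⊆ t ∧ t.card = 4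

/-- The tetrahedra `K ∈ 𝒯`. -/
def tets (T : Geometry.SimplicialComplex ℝ E3) : Set (Finset E3) :=
  {K | K ∈ T.faces ∧ K.card = 4}

/-- The two-dimensional facets `F ∈ ℱ`. -/
def triangles (T : Geometry.SimplicialComplex ℝ E3) : Set (Finset E3) :=
  {F | F ∈ T.faces ∧ F.card = 3}

/-- The edges `E ∈ ℰ`. -/
def edges (T : Geometry.SimplicialComplex ℝ E3) : Set (Finset E3) :=
  {E | E ∈ T.faces ∧ E.card = 2}

/-- The meshed domain `Ω = dom 𝒯`, the interior of the union of all closed tetrahedra. -/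
def dom (T : Geometry.SimplicialComplex ℝ E3) : Set E3 :=
  interior (⋃ K ∈ tets T, convexHull ℝ (K : Set E3))

/-- The boundary edges: edges contained in `∂Ω`. -/
def boundaryEdges (T : Geometry.SimplicialComplex ℝ E3) : Set (Finset E3) :=
  {E | E ∈ edges T ∧ convexHull ℝ (E : Set E3) ⊆ frontier (dom T)}

/-- The inner edges: all edges that are not boundary edges. -/
def innerEdges (T : Geometry.SimplicialComplex ℝ E3) : Set (Finset E3) :=
  edges T \ boundaryEdges T

/-- The edge patch `𝒯_E`: the tetrahedra that contain the edge `E`. -/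
def edgePatch (T : Geometry.SimplicialComplex ℝ E3) (E : Finset E3) : Set (Finset E3) :=
  {K | K ∈ tets T ∧ E ⊆ K}

/-- A flat plane in `ℝ³`. -/
def IsPlane (P : AffineSubspace ℝ E3) : Prop :=
  (P : Set E3).Nonempty ∧ Module.finrank ℝ P.direction = 2

/-- An edge is critical if all facets containing it lie in at most two flat planes. -/
def IsCriticalEdge (T : Geometry.SimplicialComplex ℝ E3) (E : Finset E3) : Prop :=
  E ∈ edges T ∧ ∃ P Q : AffineSubspace ℝ E3, IsPlane P ∧ IsPlane Q ∧
    ∀ F ∈ triangles T, E ⊆ F →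
      convexHull ℝ (F : Set E3) ⊆ (P : Set E3) ∨ convexHull ℝ (F : Set E3) ⊆ (Q : Set E3)

/-- The simplices `K` and `K'` have a common two-dimensional facet. -/
def ShareFacet (T : Geometry.SimplicialComplex ℝ E3) (K K' : Finset E3) : Prop :=
  ∃ F ∈ triangles T, F ⊆ K ∧ F ⊆ K'

/-- An admissible numbering `K₀, …, Kₙ₋₁` of the edge patch `𝒯_E`: every tetrahedron of the patch is
listed exactly once, and consecutive ones share a facet.  The latter is only demanded for patches of
at least three tetrahedra, since the numbering of a smaller patch is arbitrary. -/
structure IsPatchNumbering (T : Geometry.SimplicialComplex ℝ E3) (E : Finset E3) {n : ℕ}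
    (K : Fin n → Finset E3) : Prop where
  injective : Function.Injective K
  range_eq : Set.range K = edgePatch T E
  share : 3 ≤ n → ∀ i j : Fin n, (j : ℕ) = (i : ℕ) + 1 → ShareFacet T (K i) (K j)

/-- The cyclic convention for a patch of four tetrahedra: `Kᵢ` and `Kᵢ₊₁` (indices modulo 4) share a
facet `Fᵢ`, the facets `F₀, F₂` lie in one plane and `F₁, F₃` lie in another plane. -/
def IsCyclicNumbering (T : Geometry.SimplicialComplex ℝ E3) (K : Fin 4 → Finset E3) : Prop :=
  ∃ (F : Fin 4 → Finset E3) (P Q : AffineSubspace ℝ E3),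
    (∀ i, F i ∈ triangles T ∧ F i ⊆ K i ∧ F i ⊆ K (i + 1)) ∧
    IsPlane P ∧ IsPlane Q ∧ P ≠ Q ∧
    convexHull ℝ (F 0 : Set E3) ⊆ (P : Set E3) ∧ convexHull ℝ (F 2 : Set E3) ⊆ (P : Set E3) ∧
    convexHull ℝ (F 1 : Set E3) ⊆ (Q : Set E3) ∧ convexHull ℝ (F 3 : Set E3) ⊆ (Q : Set E3)

/-! ### Barycentric coordinates and Jacobi polynomials -/

open Classical in
/-- The barycentric coordinate `λ_{K,z}`: the affine function with value `1` at `z` and value `0` at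
all other vertices of `K` (see `exists_baryCoord`, `baryCoord_spec` and `baryCoord_unique`). -/
def baryCoord (K : Finset E3) (z : E3) : E3 →ᵃ[ℝ] ℝ :=
  if h : ∃ f : E3 →ᵃ[ℝ] ℝ, f z = 1 ∧ ∀ y ∈ K, y ≠ z → f y = 0 then h.choose else 0

lemma affineSpan_tet {K : Finset E3} (hK : AffineIndependent ℝ ((↑) : K → E3))
    (hc : K.card = 4) : affineSpan ℝ (Set.range ((↑) : K → E3)) = ⊤ := by
  rw [hK.affineSpan_eq_top_iff_card_eq_finrank_add_one]
  simp [hc]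

lemma exists_baryCoord {K : Finset E3} (hK : AffineIndependent ℝ ((↑) : K → E3))
    (hc : K.card = 4) {z : E3} (hz : z ∈ K) :
    ∃ f : E3 →ᵃ[ℝ] ℝ, f z = 1 ∧ ∀ y ∈ K, y ≠ z → f y = 0 := by
  let b : AffineBasis K ℝ E3 := ⟨(↑), hK, affineSpan_tet hK hc⟩
  refine ⟨b.coord ⟨z, hz⟩, b.coord_apply_eq ⟨z, hz⟩, fun y hy hyz => ?_⟩
  exact b.coord_apply_ne (i := ⟨z, hz⟩) (j := ⟨y, hy⟩) (fun h => hyz (congrArg Subtype.val h).symm)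

lemma baryCoord_spec {K : Finset E3} (hK : AffineIndependent ℝ ((↑) : K → E3))
    (hc : K.card = 4) {z : E3} (hz : z ∈ K) :
    baryCoord K z z = 1 ∧ ∀ y ∈ K, y ≠ z → baryCoord K z y = 0 := by
  have h := exists_baryCoord hK hc hz
  rw [baryCoord, dif_pos h]
  exact h.choose_spec

lemma baryCoord_unique {K : Finset E3} (hK : AffineIndependent ℝ ((↑) : K → E3))
    (hc : K.card = 4) {z : E3} (hz : z ∈ K) (f : E3 →ᵃ[ℝ] ℝ) (h1 : f z = 1)
    (h0 : ∀ y ∈ K, y ≠ z → f y = 0) : f = baryCoord K z := by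
  obtain ⟨g1, g0⟩ := baryCoord_spec hK hc hz
  refine AffineMap.ext_on (affineSpan_tet hK hc) ?_
  rintro _ ⟨y, rfl⟩
  by_cases hy : (y : E3) = z
  · simp only [hy, h1, g1]
  · rw [h0 y y.2 hy, g0 y y.2 hy]

/-- The Jacobi polynomial
`P_n^{(α,β)}(x) = ∑ₛ (n+α+β+1)ₛ (α+s+1)ₙ₋ₛ / (s! (n-s)!) * ((x-1)/2)ˢ`,
with `(a)ₛ = a (a+1) ⋯ (a+s-1)`. -/
def jacobiPoly (α β : ℝ) (n : ℕ) : Polynomial ℝ :=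
  ∑ s ∈ Finset.range (n + 1),
    Polynomial.C ((ascPochhammer ℝ s).eval (n + α + β + 1)
        * (ascPochhammer ℝ (n - s)).eval (α + s + 1)
        / (Nat.factorial s * Nat.factorial (n - s)))
      * (Polynomial.C (1 / 2) * (Polynomial.X - 1)) ^ s

/-! ### Finite element spaces -/

/-- On the set `D` the function `f` is a polynomial of total degree at most `m`, up to a set of
measure zero. -/
def AEPolyOn (m : ℕ) (f : E3 → ℝ) (D : Set E3) : Prop :=
  ∃ q : MvPolynomial (Fin 3) ℝ, q.totalDegree ≤ m ∧
    f =ᵐ[volume.restrict D] fun x => MvPolynomial.eval (fun i => x i) q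

/-- The scalar space `S_{k,0}(𝒯)`: functions that are continuous on `Ω`, are on each closed
tetrahedron a polynomial of degree at most `k`, and vanish on `∂Ω`; they are extended by zero
outside of `Ω`. -/
def scalarSpace (T : Geometry.SimplicialComplex ℝ E3) (k : ℕ) : Set (E3 → ℝ) :=
  {v | ContinuousOn v (dom T) ∧
    (∀ K ∈ tets T, ∃ q : MvPolynomial (Fin 3) ℝ, q.totalDegree ≤ k ∧
      ∀ x ∈ convexHull ℝ (K : Set E3), v x = MvPolynomial.eval (fun i => x i) q) ∧
    ∀ x, x ∉ dom T → v x = 0}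

/-- The conforming velocity space `𝐒_{k,0}(𝒯) = S_{k,0}(𝒯)³`. -/
def velocitySpace (T : Geometry.SimplicialComplex ℝ E3) (k : ℕ) : Set (E3 → E3) :=
  {v | ∀ i, (fun x => v x i) ∈ scalarSpace T k}

/-- The space `ℙ_m(𝒯)` of square integrable functions on `Ω` that are on each open tetrahedron a
polynomial of degree at most `m`.  Its elements are representatives of classes modulo equality
almost everywhere in `Ω`. -/
def pressureSpace (T : Geometry.SimplicialComplex ℝ E3) (m : ℕ) : Set (E3 → ℝ) :=
  {p | MemLp p 2 (volume.restrict (dom T)) ∧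
    ∀ K ∈ tets T, AEPolyOn m p (interior (convexHull ℝ (K : Set E3)))}

/-- The subspace `ℙ_{m,0}(𝒯)` of functions of integral mean zero. -/
def pressureSpaceZero (T : Geometry.SimplicialComplex ℝ E3) (m : ℕ) : Set (E3 → ℝ) :=
  {p | p ∈ pressureSpace T m ∧ ∫ x in dom T, p x = 0}

/-- The partial derivative `∂ⱼ vᵢ` at `x`. -/
def partialDeriv (v : E3 → E3) (i j : Fin 3) (x : E3) : ℝ :=
  (fderiv ℝ v x (EuclideanSpace.single j 1)) i

/-- The divergence.  For elements of the velocity space it is the classical divergence in the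
interior of each tetrahedron, hence almost everywhere the weak divergence. -/
def divergence (v : E3 → E3) (x : E3) : ℝ :=
  ∑ i, partialDeriv v i i x

/-- The bilinear form `b(p, v) = (p, div v)_{L²(Ω)}`. -/
def bForm (T : Geometry.SimplicialComplex ℝ E3) (p : E3 → ℝ) (v : E3 → E3) : ℝ :=
  ∫ x in dom T, p x * divergence v x

/-- The norm of `L²(Ω)`. -/
def l2Norm (T : Geometry.SimplicialComplex ℝ E3) (p : E3 → ℝ) : ℝ :=
  Real.sqrt (∫ x in dom T, p x * p x)

/-- The norm `‖v‖ = ‖∇v‖_{L²(Ω)}` of the velocity space. -/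
def velocityNorm (T : Geometry.SimplicialComplex ℝ E3) (v : E3 → E3) : ℝ :=
  Real.sqrt (∫ x in dom T, ∑ i, ∑ j, partialDeriv v i j x ^ 2)

/-- Inf-sup stability of a pair of a velocity space `V` and a pressure space `M`: there is `γ > 0` with
`inf_{p ∈ M∖{0}} sup_{v ∈ V∖{0}} b(p,v) / (‖v‖ ‖p‖_{L²}) ≥ γ`, where a pressure counts as zero if it
vanishes almost everywhere in `Ω`.  Infimum and supremum are taken in the extended reals. -/
def InfSupStable (T : Geometry.SimplicialComplex ℝ E3) (V : Set (E3 → E3)) (M : Set (E3 → ℝ)) :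
    Prop :=
  ∃ γ : ℝ, 0 < γ ∧
    (γ : EReal) ≤ ⨅ p ∈ {p | p ∈ M ∧ ¬ p =ᵐ[volume.restrict (dom T)] 0},
      ⨆ v ∈ {v | v ∈ V ∧ v ≠ 0},
        ((bForm T p v / (velocityNorm T v * l2Norm T p) : ℝ) : EReal)

/-! ### Critical pressures -/

/-- A critical pressure of the conforming `(k, k-1)` pair: a non-zero function in `ℙ_{k-1,0}(𝒯)` that
is orthogonal to the divergence of every conforming velocity. -/
def IsCriticalPressure (T : Geometry.SimplicialComplex ℝ E3) (k : ℕ) (p : E3 → ℝ) : Prop :=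
  p ∈ pressureSpaceZero T (k - 1) ∧ ¬ p =ᵐ[volume.restrict (dom T)] 0 ∧
    ∀ v ∈ velocitySpace T k, bForm T p v = 0

/-- The function `p_{k-1}^{E,p} = ∑ᵢ (-1)ⁱ / |Kᵢ| χ_{Kᵢ} P_{k-1}^{(0,3)}(1 - 2 λ_{Kᵢ,p})` for a numbering
of the patch of `E`.  The list starts with index `0` here and with index `1` in the sum, hence the
exponent `i + 1`. -/
def critPressure (k : ℕ) {n : ℕ} (K : Fin n → Finset E3) (p : E3) : E3 → ℝ := fun x =>
  ∑ i : Fin n, (-1 : ℝ) ^ ((i : ℕ) + 1) / volume.real (convexHull ℝ (K i : Set E3)) *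
    (convexHull ℝ (K i : Set E3)).indicator
      (fun y => (jacobiPoly 0 3 (k - 1)).eval (1 - 2 * baryCoord (K i) p y)) x

end

/-! The proof separates an integral identity on one tetrahedron from the geometry around the edge.

On a tetrahedron `K` with vertex `p`, the function `P^{(0,3)}_{k-1}(1 - 2λ_p)` acts as a point
evaluation: its integral against a polynomial `g` of degree at most `k - 1` is a constant times `|K|
g(p)`. With `p` as origin, `K` is a cone truncated at `s = 1 - λ_p = 1`, and a homogeneous `g` of
degree `j` contributes the factor `∫ P(2r - 1) r^(j+2) dr` over `[0,1]`. For `1 ≤ j ≤ k - 1` this is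
zero because `P` is orthogonal to lower powers with weight `r^3` (`integral_jacobiPoly_mul_pow`).
This is `integral_tet_jacobiPoly`. The factor `1/|Kᵢ|` cancels the volume, so the pairing with `div
v` is a multiple of the alternating sum of the values of `div v|_{Kᵢ}` at `p`
(`integral_dom_critPressure_mul`).

That sum vanishes already for the full gradient of each component. Take affine functions `α, β`
vanishing on `E`, `α` also on the plane `Q` and `β` on the plane `P` (`EdgeFrame`). Each tetrahedron
of the patch fills one of the four wedges given by the signs of `α` and `β`, and no wedge is used
twice. Assign the zero functional to empty wedges. Across a facet on `P` the gradients differ by a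
multiple of `dβ`, because the traces agree, or vanish if the facet has only one tetrahedron. Across
a facet on `Q` they differ by a multiple of `dα`. Grouped in these two ways, the alternating sum is
a multiple both of `dα` and of `dβ`, hence zero (`Compatible.sum_eq_zero`, `compatible_polyGrad`).

An inner edge has a point of the open domain in its relative interior, so all four wedges are
occupied; at a boundary edge one is empty. This gives the numberings. For instability, an orthogonal
pressure that is not constant remains non-zero and orthogonal after subtraction of its mean, since
velocities vanish outside the domain and `∫ div v = 0` (`not_infSupStable_of_not_const`). Critical
functions are constant only in the excluded case (`not_critPressure_ae_eq_const`). -/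

/-! ### Orthogonality of the Jacobi polynomials with parameters `(0,3)` -/

lemma integral_one_sub_pow_mul_pow (s m : ℕ) :
    ∫ r in (0:ℝ)..1, (1 - r) ^ s * r ^ m =
      (s.factorial * m.factorial : ℝ) / (s + m + 1).factorial := by
  induction s generalizing m with
  | zero =>
    simp [Nat.factorial_succ]
    field_simp
  | succ s ih =>
    have h : ∀ r : ℝ, (1 - r) ^ (s + 1) * r ^ m = (1 - r) ^ s * r ^ m - (1 - r) ^ s * r ^ (m + 1) := by
      intro r; ring
    simp_rw [h]
    rw [intervalIntegral.integral_sub (Continuous.intervalIntegrable (by fun_prop) _ _)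
      (Continuous.intervalIntegrable (by fun_prop) _ _), ih, ih]
    rw [show s + 1 + m + 1 = (s + m + 1) + 1 by ring, show s + (m + 1) + 1 = (s + m + 1) + 1 by ring]
    simp only [Nat.factorial_succ (s + m + 1), Nat.factorial_succ s, Nat.factorial_succ m]
    push_cast
    field_simp
    ring

lemma ascPochhammer_eval_natCast_succ (a s : ℕ) :
    (ascPochhammer ℝ s).eval ((a : ℝ) + 1) = ((a + s).factorial : ℝ) / a.factorial := by
  rw [← Nat.cast_succ, ← ascPochhammer_eval_cast, ascPochhammer_nat_eq_ascFactorial, eq_div_iff (by positivity), mul_comm]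
  exact_mod_cast Nat.factorial_mul_ascFactorial a s

lemma natDegree_jacobiPoly_le (α β : ℝ) (n : ℕ) : (jacobiPoly α β n).natDegree ≤ n := by
  refine Polynomial.natDegree_sum_le_of_forall_le _ _ fun s hs => ?_
  refine (Polynomial.natDegree_C_mul_le _ _).trans ?_
  refine (Polynomial.natDegree_pow_le).trans ?_
  have h1 : (Polynomial.C (1 / 2) * (Polynomial.X - 1) : Polynomial ℝ).natDegree ≤ 1 := by
    refine (Polynomial.natDegree_C_mul_le _ _).trans ?_
    simpa using (Polynomial.natDegree_X_sub_C (1 : ℝ)).le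
  have : s ≤ n := by simpa [Nat.lt_succ_iff] using hs
  nlinarith

lemma jacobiPoly_zero_eval_one (n : ℕ) : (jacobiPoly 0 3 n).eval 1 = 1 := by
  rw [jacobiPoly, Polynomial.eval_finsetSum, Finset.sum_eq_single 0]
  · have := ascPochhammer_eval_natCast_succ 0 n
    simp at this
    have h2 : (n.factorial : ℝ) ≠ 0 := by positivity
    simp [h2]
  · intro s _ hs
    simp [hs]
  · simp

lemma jacobiPoly_eval (n : ℕ) (r : ℝ) :
    (jacobiPoly 0 3 n).eval (2 * r - 1) = ∑ s ∈ Finset.range (n + 1),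
      (-1) ^ s * (n.choose s : ℝ) * ((n + 3 + s).factorial / ((n + 3).factorial * s.factorial)) *
        (1 - r) ^ s := by
  rw [jacobiPoly, Polynomial.eval_finsetSum]
  refine Finset.sum_congr rfl fun s hs => ?_
  have hs : s ≤ n := by simpa [Nat.lt_succ_iff] using hs
  have h1 := ascPochhammer_eval_natCast_succ (n + 3) s
  have h2 := ascPochhammer_eval_natCast_succ s (n - s)
  have e1 : (n : ℝ) + 0 + 3 + 1 = ((n + 3 : ℕ) : ℝ) + 1 := by push_cast; ring
  have e2 : (0 : ℝ) + s + 1 = (s : ℝ) + 1 := by ring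
  rw [Nat.add_sub_cancel' hs] at h2
  simp only [e1, e2, h1, h2, Polynomial.eval_mul, Polynomial.eval_C, Polynomial.eval_pow,
    Polynomial.eval_sub, Polynomial.eval_X, Polynomial.eval_one]
  rw [Nat.cast_choose ℝ hs, show (1 / 2 * (2 * r - 1 - 1) : ℝ) = (-1) * (1 - r) by ring, mul_pow]
  field_simp

/-- Up to the sign `(-1)^n`, the sum is the `n`-th forward difference of `P` at `0`, which is zero
for degree below `n`. -/
lemma sum_neg_one_pow_mul_choose_mul_eval_eq_zero (P : Polynomial ℝ) (n : ℕ)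
    (h : P.natDegree < n) :
    ∑ s ∈ Finset.range (n + 1), (-1) ^ s * (n.choose s : ℝ) * P.eval (s : ℝ) = 0 := by
  have h1 := congrFun (Polynomial.fwdDiff_iter_eq_zero_of_degree_lt h) 0
  rw [fwdDiff_iter_eq_sum_shift] at h1
  simp only [Pi.zero_apply, zero_add, nsmul_eq_mul, mul_one, zsmul_eq_mul] at h1
  have h2 : ∀ s ∈ Finset.range (n + 1), (-1 : ℝ) ^ s * (n.choose s : ℝ) * P.eval (s : ℝ) =
      (-1) ^ n * ((((-1 : ℤ) ^ (n - s) * (n.choose s : ℤ) : ℤ) : ℝ) * P.eval (s : ℝ)) := by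
    intro s hs
    have hs : s ≤ n := by simpa [Nat.lt_succ_iff] using hs
    push_cast
    have : (-1 : ℝ) ^ n * (-1) ^ (n - s) = (-1) ^ s := by
      obtain ⟨d, rfl⟩ := Nat.exists_eq_add_of_le hs
      rw [Nat.add_sub_cancel_left, pow_add, mul_assoc, ← mul_pow]; simp
    rw [← this]; ring
  rw [Finset.sum_congr rfl h2, ← Finset.mul_sum, h1, mul_zero]

/-- With `x = 2r - 1`, the weight `(1 + x)^3` becomes a multiple of `r^3`. Expanding in powers of `1
- r` turns each term into a Beta integral, and the resulting alternating binomial sum is an `n`-th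
difference of a polynomial of degree `n - 1 - i`. -/
lemma integral_jacobiPoly_mul_pow (n i : ℕ) (hi : i < n) :
    ∫ r in (0:ℝ)..1, (jacobiPoly 0 3 n).eval (2 * r - 1) * r ^ (i + 3) = 0 := by
  simp_rw [jacobiPoly_eval, Finset.sum_mul]
  rw [intervalIntegral.integral_finsetSum
    fun s _ => Continuous.intervalIntegrable (by fun_prop) _ _]
  simp_rw [mul_assoc, intervalIntegral.integral_const_mul, integral_one_sub_pow_mul_pow]
  -- `P(s) = (n+3+s)! / (s+i+4)!`: this quotient of the factorials from the Jacobi coefficient and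
  -- from the Beta integral is a rising factorial in `s`.
  set P : Polynomial ℝ := (ascPochhammer ℝ (n - 1 - i)).comp
    (Polynomial.X + Polynomial.C ((i : ℝ) + 5)) with hP
  have hdeg : P.natDegree < n := by
    rw [hP, Polynomial.natDegree_comp, ascPochhammer_natDegree, Polynomial.natDegree_X_add_C]
    omega
  have h0 := sum_neg_one_pow_mul_choose_mul_eval_eq_zero P n hdeg
  have : ∀ s ∈ Finset.range (n + 1),
      (-1 : ℝ) ^ s * ((n.choose s : ℝ) * ((n + 3 + s).factorial / ((n + 3).factorial * s.factorial) *
        ((s.factorial * (i + 3).factorial : ℝ) / (s + (i + 3) + 1).factorial))) =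
      ((i + 3).factorial / (n + 3).factorial : ℝ) * ((-1) ^ s * (n.choose s : ℝ) * P.eval (s : ℝ)) := by
    intro s _
    have e := ascPochhammer_eval_natCast_succ (s + i + 4) (n - 1 - i)
    have e1 : P.eval (s : ℝ) = (ascPochhammer ℝ (n - 1 - i)).eval (((s + i + 4 : ℕ) : ℝ) + 1) := by
      rw [hP, Polynomial.eval_comp]; push_cast
      congr 1
      simp; ring
    rw [e1, e, show s + i + 4 + (n - 1 - i) = n + 3 + s by omega, show s + (i + 3) + 1 = s + i + 4 by ring]
    field_simp
  rw [Finset.sum_congr rfl this, ← Finset.mul_sum, h0, mul_zero]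

/-! ### Polynomial functions on space -/

/-- The function `f` is a polynomial of total degree at most `m`. -/
def IsPolyFn (m : ℕ) (f : E3 → ℝ) : Prop :=
  ∃ q : MvPolynomial (Fin 3) ℝ, q.totalDegree ≤ m ∧
    ∀ x, f x = MvPolynomial.eval (fun i => x i) q

namespace IsPolyFn

lemma mono {m n : ℕ} {f : E3 → ℝ} (h : IsPolyFn m f) (hmn : m ≤ n) : IsPolyFn n f := by
  obtain ⟨q, hq, h⟩ := h
  exact ⟨q, hq.trans hmn, h⟩

lemma const (m : ℕ) (c : ℝ) : IsPolyFn m fun _ => c :=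
  ⟨MvPolynomial.C c, by simp, by simp⟩

lemma coord (i : Fin 3) : IsPolyFn 1 fun x => x i :=
  ⟨MvPolynomial.X i, by simp, by simp⟩

lemma add {m : ℕ} {f g : E3 → ℝ} (hf : IsPolyFn m f) (hg : IsPolyFn m g) :
    IsPolyFn m fun x => f x + g x := by
  obtain ⟨q, hq, h⟩ := hf
  obtain ⟨q', hq', h'⟩ := hg
  exact ⟨q + q', (MvPolynomial.totalDegree_add _ _).trans (max_le hq hq'), by simp [h, h']⟩

lemma mul {m n : ℕ} {f g : E3 → ℝ} (hf : IsPolyFn m f) (hg : IsPolyFn n g) :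
    IsPolyFn (m + n) fun x => f x * g x := by
  obtain ⟨q, hq, h⟩ := hf
  obtain ⟨q', hq', h'⟩ := hg
  exact ⟨q * q', (MvPolynomial.totalDegree_mul _ _).trans (add_le_add hq hq'), by simp [h, h']⟩

lemma const_mul {m : ℕ} {f : E3 → ℝ} (c : ℝ) (hf : IsPolyFn m f) :
    IsPolyFn m fun x => c * f x := by
  simpa using (const 0 c).mul hf

lemma sum {ι : Type*} {m : ℕ} (s : Finset ι) {f : ι → E3 → ℝ} (hf : ∀ i ∈ s, IsPolyFn m (f i)) :
    IsPolyFn m fun x => ∑ i ∈ s, f i x := by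
  classical
  induction s using Finset.induction_on with
  | empty => simpa using const m 0
  | insert a s ha ih =>
    simp_rw [Finset.sum_insert ha]
    exact (hf a (by simp)).add (ih fun i hi => hf i (by simp [hi]))

lemma pow {m : ℕ} {f : E3 → ℝ} (hf : IsPolyFn m f) (n : ℕ) : IsPolyFn (n * m) fun x => f x ^ n := by
  induction n with
  | zero => simpa using const 0 1
  | succ n ih =>
    simp_rw [pow_succ, Nat.succ_mul]
    exact ih.mul hf

lemma prod {ι : Type*} (s : Finset ι) {m : ι → ℕ} {f : ι → E3 → ℝ}
    (hf : ∀ i ∈ s, IsPolyFn (m i) (f i)) :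
    IsPolyFn (∑ i ∈ s, m i) fun x => ∏ i ∈ s, f i x := by
  classical
  induction s using Finset.induction_on with
  | empty => simpa using const 0 1
  | insert a s ha ih =>
    simp_rw [Finset.prod_insert ha, Finset.sum_insert ha]
    exact (hf a (by simp)).mul (ih fun i hi => hf i (by simp [hi]))

lemma linear (f : E3 →ₗ[ℝ] ℝ) : IsPolyFn 1 f := by
  have h : ∀ x, f x = ∑ i, f (EuclideanSpace.single i 1) * x i := by
    intro x
    have hx : x = ∑ i, x i • (EuclideanSpace.single i (1 : ℝ) : E3) := by
      ext j; simp [Finset.sum_apply, Pi.single_apply]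
    conv_lhs => rw [hx]
    simp [mul_comm]
  have := sum (m := 1) Finset.univ (f := fun i x => f (EuclideanSpace.single i 1) * x i)
    fun i _ => (coord i).const_mul _
  simpa only [← h] using this

lemma affine (f : E3 →ᵃ[ℝ] ℝ) : IsPolyFn 1 f := by
  have := (linear f.linear).add (const 1 (f 0))
  have e : ∀ x, f x = f.linear x + f 0 := fun x => by simpa using congrFun f.decomp x
  simpa only [← e] using this

lemma comp_polynomial {f : E3 → ℝ} (hf : IsPolyFn 1 f) (P : Polynomial ℝ) {m : ℕ}
    (hP : P.natDegree ≤ m) : IsPolyFn m fun x => P.eval (f x) := by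
  simp_rw [Polynomial.eval_eq_sum_range]
  refine sum _ fun i hi => const_mul _ ((hf.pow i).mono ?_)
  have := Finset.mem_range.1 hi
  omega

lemma translate {m : ℕ} {f : E3 → ℝ} (hf : IsPolyFn m f) (z : E3) :
    IsPolyFn m fun x => f (z + x) := by
  obtain ⟨q, hq, h⟩ := hf
  simp_rw [h, MvPolynomial.eval_eq]
  refine sum _ fun d hd => const_mul _ (mono (prod _ (m := fun i => d i * 1)
    fun i _ => IsPolyFn.pow ?_ _) ?_)
  · simpa [add_comm] using (coord i).add (const 1 (z i))
  · refine le_trans ?_ ((MvPolynomial.le_totalDegree hd).trans hq)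
    simp [Finsupp.sum]

lemma continuous {m : ℕ} {f : E3 → ℝ} (hf : IsPolyFn m f) : Continuous f := by
  obtain ⟨q, -, h⟩ := hf
  rw [show f = _ from funext h]
  exact q.continuous_eval.comp (by fun_prop)

end IsPolyFn

lemma hasFDerivAt_mvPolynomial_eval (q : MvPolynomial (Fin 3) ℝ) (x : E3) :
    HasFDerivAt (fun y : E3 => MvPolynomial.eval (fun i => y i) q)
      (∑ i, MvPolynomial.eval (fun i => x i) (MvPolynomial.pderiv i q) •
        (EuclideanSpace.proj i : E3 →L[ℝ] ℝ)) x := by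
  induction q using MvPolynomial.induction_on with
  | C a => simpa using hasFDerivAt_const a x
  | add p q hp hq =>
    simp only [map_add, add_smul, Finset.sum_add_distrib]
    exact hp.add hq
  | mul_X p i hp =>
    have h := hp.mul ((EuclideanSpace.proj i : E3 →L[ℝ] ℝ).hasFDerivAt (x := x))
    simp only [map_mul, MvPolynomial.eval_X]
    refine h.congr_fderiv ?_
    ext j
    simp [MvPolynomial.pderiv_X, Pi.single_apply, add_mul,
      Finset.sum_add_distrib, Finset.mul_sum, apply_ite]
    ring_nf

lemma totalDegree_pderiv_le (q : MvPolynomial (Fin 3) ℝ) (i : Fin 3) {m : ℕ}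
    (h : q.totalDegree ≤ m) : (MvPolynomial.pderiv i q).totalDegree ≤ m - 1 := by
  refine Finset.sup_le fun d hd => ?_
  rw [MvPolynomial.mem_support_iff, MvPolynomial.coeff_pderiv] at hd
  have h1 : d + Finsupp.single i 1 ∈ q.support :=
    MvPolynomial.mem_support_iff.2 (left_ne_zero_of_mul hd)
  have h2 := (MvPolynomial.le_totalDegree h1).trans h
  rw [Finsupp.sum_add_index' (by simp) (by simp)] at h2
  simp at h2
  omega

/-! ### Integration over truncated cones -/

-- Radial integration without polar coordinates. The slice `{s ≤ r}` of the truncated cone `D` is `r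
-- • D`, so homogeneity gives `∫ h = r^(j+3) ∫_D h` over it. Writing `1 - s^m` as the integral of `m
-- r^(m-1)` over `[s, 1]` and exchanging integrals yields the claim.
open scoped Pointwise in
lemma integral_truncatedCone_pow {C : Set E3} (s : E3 →ₗ[ℝ] ℝ)
    (hs : ∀ y ∈ C, 0 ≤ s y) (hcone : ∀ r : ℝ, 0 < r → ∀ y ∈ C, r • y ∈ C)
    (hD : IsCompact {y | y ∈ C ∧ s y ≤ 1}) {h : E3 → ℝ} (hc : Continuous h) {j : ℕ}
    (hj : ∀ (r : ℝ) y, h (r • y) = r ^ j * h y) (m : ℕ) :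
    ∫ y in {y | y ∈ C ∧ s y ≤ 1}, s y ^ m * h y =
      ((j + 3) * ∫ r in (0 : ℝ)..1, r ^ m * r ^ (j + 2)) *
        ∫ y in {y | y ∈ C ∧ s y ≤ 1}, h y := by
  set D := {y | y ∈ C ∧ s y ≤ 1} with hDdef
  set H := ∫ y in D, h y with hH
  have hsc : Continuous s := s.continuous_of_finiteDimensional
  have hint : ∀ f : E3 → ℝ, Continuous f → IntegrableOn f D := fun f hf =>
    hf.continuousOn.integrableOn_compact hD
  have key : ∫ r in (0 : ℝ)..1, r ^ m * r ^ (j + 2) = 1 / (m + j + 3) := by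
    simp_rw [← pow_add]
    rw [integral_pow]
    push_cast
    simp
    ring
  have h3 : (m + j + 3 : ℝ) ≠ 0 := by positivity
  rw [key]
  -- The layer formula below uses the exponent `m - 1`, so `m = 0` is settled separately.
  rcases Nat.eq_zero_or_pos m with rfl | hm
  · have : (j + 3 : ℝ) ≠ 0 := by positivity
    simp [this, ← hH]
  -- the slices
  have slice : ∀ r ∈ Set.Ioc (0 : ℝ) 1, ∫ y in D, {y | s y ≤ r}.indicator h y = r ^ (j + 3) * H := by
    intro r hr
    rw [setIntegral_indicator (measurableSet_le hsc.measurable measurable_const)]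
    have hset : D ∩ {y | s y ≤ r} = r • D := by
      ext y
      rw [Set.mem_smul_set_iff_inv_smul_mem₀ hr.1.ne']
      simp only [hDdef, Set.mem_inter_iff, Set.mem_ofPred_eq, map_smul, smul_eq_mul]
      constructor
      · rintro ⟨⟨h1, -⟩, h2⟩
        exact ⟨hcone _ (inv_pos.2 hr.1) _ h1, by rw [inv_mul_le_iff₀ hr.1]; simpa using h2⟩
      · rintro ⟨h1, h2⟩
        rw [inv_mul_le_iff₀ hr.1, mul_one] at h2
        refine ⟨⟨?_, h2.trans hr.2⟩, h2⟩
        simpa [smul_smul, hr.1.ne'] using hcone r hr.1 _ h1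
    have := Measure.setIntegral_comp_smul_of_pos (volume : Measure E3) h D hr.1
    rw [hset]
    simp only [finrank_euclideanSpace, Fintype.card_fin, smul_eq_mul, hj] at this
    rw [integral_const_mul, ← hH] at this
    have hr0 : r ≠ 0 := hr.1.ne'
    field_simp at this
    rw [← this]; ring
  -- Fubini
  have hF : Integrable (Function.uncurry fun (y : E3) (r : ℝ) =>
      {y | s y ≤ r}.indicator h y * (m * r ^ (m - 1)))
      ((volume.restrict D).prod (volume.restrict (Set.Ioc (0 : ℝ) 1))) := by
    have h1 : Integrable (fun z : E3 × ℝ => h z.1 * (m * z.2 ^ (m - 1)))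
        ((volume.restrict D).prod (volume.restrict (Set.Ioc (0 : ℝ) 1))) :=
      Integrable.mul_prod (hint h hc)
        (Continuous.integrableOn_Ioc (f := fun r : ℝ => (m : ℝ) * r ^ (m - 1)) (by fun_prop))
    have hm : MeasurableSet {z : E3 × ℝ | s z.1 ≤ z.2} :=
      measurableSet_le (by fun_prop) (by fun_prop)
    refine (h1.indicator hm).congr (Filter.Eventually.of_forall ?_)
    rintro ⟨y, r⟩
    by_cases hy : s y ≤ r <;> simp [Set.indicator, hy]
  have swap := integral_integral_swap hF
  have lhs : ∀ y ∈ D, ∫ r in Set.Ioc (0 : ℝ) 1, {y | s y ≤ r}.indicator h y * (m * r ^ (m - 1)) =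
      h y - s y ^ m * h y := by
    intro y hy
    have e1 : ∀ r : ℝ, {y | s y ≤ r}.indicator h y * (m * r ^ (m - 1)) =
        (Set.Ici (s y)).indicator (fun r => h y * (m * r ^ (m - 1))) r := by
      intro r; by_cases hyr : s y ≤ r <;> simp [Set.indicator, hyr]
    simp_rw [e1]
    rw [setIntegral_indicator measurableSet_Ici]
    have e2 : (Set.Ioc 0 1 ∩ Set.Ici (s y) : Set ℝ) =ᵐ[volume] Set.Ioc (s y) 1 := by
      have : (Set.Ioc (s y) 1 : Set ℝ) = Set.Ioc 0 1 ∩ Set.Ioi (s y) := by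
        ext r
        have := hs y hy.1
        simp only [Set.mem_Ioc, Set.mem_inter_iff, Set.mem_Ioi]
        constructor
        · rintro ⟨a, b⟩; exact ⟨⟨by linarith, b⟩, a⟩
        · rintro ⟨⟨_, b⟩, a⟩; exact ⟨a, b⟩
      rw [this]
      exact (Filter.EventuallyEq.refl _ _).inter Ioi_ae_eq_Ici.symm
    rw [setIntegral_congr_set e2, ← intervalIntegral.integral_of_le hy.2,
      intervalIntegral.integral_const_mul, intervalIntegral.integral_const_mul, integral_pow]
    have : ((m - 1 : ℕ) : ℝ) + 1 = m := by rw [Nat.cast_pred hm]; ring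
    rw [this, Nat.sub_add_cancel hm]
    have : (m : ℝ) ≠ 0 := by positivity
    field_simp
    ring
  rw [setIntegral_congr_fun hD.measurableSet lhs] at swap
  have rhs : ∀ r ∈ Set.Ioc (0 : ℝ) 1, ∫ y in D, {y | s y ≤ r}.indicator h y * (m * r ^ (m - 1)) =
      r ^ (m + j + 2) * (m * H) := by
    intro r hr
    rw [integral_mul_const, slice r hr]
    obtain ⟨m, rfl⟩ := Nat.exists_eq_succ_of_ne_zero hm.ne'
    simp only [Nat.succ_eq_add_one, Nat.add_sub_cancel]
    ring
  rw [setIntegral_congr_fun measurableSet_Ioc rhs, integral_mul_const,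
    ← intervalIntegral.integral_of_le zero_le_one, integral_pow,
    integral_sub (hint _ hc) (hint _ (by fun_prop)), ← hH] at swap
  have : ∫ y in D, s y ^ m * h y = H - (1 / (m + j + 3)) * (m * H) := by
    have e : ((1 : ℝ) ^ (m + j + 2 + 1) - 0 ^ (m + j + 2 + 1)) / (((m + j + 2 : ℕ) : ℝ) + 1) =
        1 / (m + j + 3) := by
      push_cast
      simp
      ring
    rw [e] at swap
    linarith
  rw [this]
  field_simp
  ring

lemma integral_truncatedCone_polynomial {C : Set E3} (s : E3 →ₗ[ℝ] ℝ)
    (hs : ∀ y ∈ C, 0 ≤ s y) (hcone : ∀ r : ℝ, 0 < r → ∀ y ∈ C, r • y ∈ C)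
    (hD : IsCompact {y | y ∈ C ∧ s y ≤ 1}) {h : E3 → ℝ} (hc : Continuous h) {j : ℕ}
    (hj : ∀ (r : ℝ) y, h (r • y) = r ^ j * h y) (P : Polynomial ℝ) :
    ∫ y in {y | y ∈ C ∧ s y ≤ 1}, P.eval (s y) * h y =
      ((j + 3) * ∫ r in (0 : ℝ)..1, P.eval r * r ^ (j + 2)) *
        ∫ y in {y | y ∈ C ∧ s y ≤ 1}, h y := by
  have hsc : Continuous s := s.continuous_of_finiteDimensional
  induction P using Polynomial.induction_on' with
  | add P Q hP hQ =>
    simp_rw [Polynomial.eval_add, add_mul]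
    rw [integral_add, intervalIntegral.integral_add, hP, hQ]
    · ring
    · exact Continuous.intervalIntegrable (by fun_prop) _ _
    · exact Continuous.intervalIntegrable (by fun_prop) _ _
    · exact (Continuous.continuousOn (by fun_prop)).integrableOn_compact hD
    · exact (Continuous.continuousOn (by fun_prop)).integrableOn_compact hD
  | monomial m a =>
    simp_rw [Polynomial.eval_monomial, mul_assoc]
    rw [integral_const_mul, intervalIntegral.integral_const_mul,
      integral_truncatedCone_pow s hs hcone hD hc hj m]
    ring

/-- The normalisation of the reproducing property of the Jacobi polynomials on tetrahedra. -/
noncomputable def jacobiMean (n : ℕ) : ℝ := 3 * ∫ r in (0 : ℝ)..1, (jacobiPoly 0 3 n).eval (2 * r - 1) * r ^ 2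

/-- Each monomial of `g` is homogeneous, so its integral splits off a radial factor. Degree `j ≥ 1`
supplies `r^(j+2) = r^((j-1)+3)` with `j - 1 < n`, which is killed by orthogonality; only the
constant term remains. The parameter `3` is thus the Jacobian exponent `2` plus one. -/
lemma integral_truncatedCone_jacobiPoly {C : Set E3} (s : E3 →ₗ[ℝ] ℝ)
    (hs : ∀ y ∈ C, 0 ≤ s y) (hcone : ∀ r : ℝ, 0 < r → ∀ y ∈ C, r • y ∈ C)
    (hD : IsCompact {y | y ∈ C ∧ s y ≤ 1}) {n : ℕ} {g : E3 → ℝ} (hg : IsPolyFn n g) :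
    ∫ y in {y | y ∈ C ∧ s y ≤ 1}, (jacobiPoly 0 3 n).eval (2 * s y - 1) * g y =
      jacobiMean n * volume.real {y | y ∈ C ∧ s y ≤ 1} * g 0 := by
  have hsc : Continuous s := s.continuous_of_finiteDimensional
  obtain ⟨q, hq, h⟩ := hg
  simp_rw [h, MvPolynomial.eval_eq, Finset.mul_sum]
  rw [integral_finsetSum]
  swap
  · intro d _
    exact (Continuous.continuousOn (by fun_prop)).integrableOn_compact hD
  refine Finset.sum_congr rfl fun d hd => ?_
  set P : Polynomial ℝ := (jacobiPoly 0 3 n).comp (2 * Polynomial.X - 1) with hP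
  have hPe : ∀ r, (jacobiPoly 0 3 n).eval (2 * r - 1) = P.eval r := by
    intro r; simp [hP, Polynomial.eval_comp]
  have hdeg : ∑ i, d i ≤ n := by
    refine le_trans ?_ ((MvPolynomial.le_totalDegree hd).trans hq)
    simp [Finsupp.sum_fintype]
  have := integral_truncatedCone_polynomial s hs hcone hD (h := fun y => ∏ i, y i ^ d i)
    (by fun_prop) (j := ∑ i, d i)
    (fun r y => by simp [mul_pow, Finset.prod_mul_distrib, Finset.prod_pow_eq_pow_sum]) P
  have e : ∀ y : E3, (jacobiPoly 0 3 n).eval (2 * s y - 1) *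
      (MvPolynomial.coeff d q * ∏ i ∈ d.support, y i ^ d i) =
      MvPolynomial.coeff d q * (P.eval (s y) * ∏ i, y i ^ d i) := by
    intro y
    rw [hPe, Finset.prod_subset (Finset.subset_univ d.support)
      (fun i _ hi => by simp [Finsupp.notMem_support_iff.1 hi])]
    ring
  simp_rw [e]
  rw [integral_const_mul, this]
  rcases Nat.eq_zero_or_pos (∑ i, d i) with h0 | h0
  · have hd0 : d = 0 := by
      ext i
      simpa using (Finset.sum_eq_zero_iff.1 h0) i (Finset.mem_univ i)
    subst hd0
    simp [jacobiMean, hPe]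
    ring
  · have h1 := integral_jacobiPoly_mul_pow n (∑ i, d i - 1) (by omega)
    rw [show ∑ i, d i - 1 + 3 = ∑ i, d i + 2 by omega] at h1
    simp_rw [hPe] at h1
    rw [h1]
    have : ∏ i ∈ d.support, ((0 : E3) i) ^ d i = 0 := by
      obtain ⟨i, hi⟩ : ∃ i, d i ≠ 0 := by
        by_contra! hcon
        simp [hcon] at h0
      exact Finset.prod_eq_zero (Finsupp.mem_support_iff.2 hi) (by simp [hi])
    rw [this]
    ring

/-! ### Barycentric coordinates of tetrahedra -/

section Tet

variable {K : Finset E3} (hK : AffineIndependent ℝ ((↑) : K → E3)) (hc : K.card = 4)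

/-- The vertices of a tetrahedron as an affine basis. -/
def tetBasis (hK : AffineIndependent ℝ ((↑) : K → E3)) (hc : K.card = 4) : AffineBasis K ℝ E3 :=
  ⟨(↑), hK, affineSpan_tet hK hc⟩

lemma tetBasis_coord (v : K) : (tetBasis hK hc).coord v = baryCoord K v := by
  refine baryCoord_unique hK hc v.2 _ ((tetBasis hK hc).coord_apply_eq v) fun y hy hyz => ?_
  exact (tetBasis hK hc).coord_apply_ne (i := v) (j := ⟨y, hy⟩)
    (fun h => hyz (congrArg Subtype.val h).symm)

lemma range_tetBasis : Set.range (tetBasis hK hc) = (K : Set E3) := Subtype.range_coe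

lemma sum_baryCoord_smul_eq (hK : AffineIndependent ℝ ((↑) : K → E3)) (hc : K.card = 4) (x : E3) :
    ∑ v ∈ K, baryCoord K v x • v = x := by
  have := (tetBasis hK hc).linear_combination_coord_eq_self x
  simp_rw [tetBasis_coord] at this
  rw [← Finset.sum_coe_sort K (fun v => baryCoord K v x • v)]
  exact this

lemma sum_baryCoord_eq_one (hK : AffineIndependent ℝ ((↑) : K → E3)) (hc : K.card = 4) (x : E3) :
    ∑ v ∈ K, baryCoord K v x = 1 := by
  have := (tetBasis hK hc).sum_coord_apply_eq_one x
  simp_rw [tetBasis_coord] at this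
  rw [← this, ← Finset.sum_coe_sort K (fun v => baryCoord K v x)]

lemma mem_convexHull_tet_iff (hK : AffineIndependent ℝ ((↑) : K → E3)) (hc : K.card = 4) {x : E3} :
    x ∈ convexHull ℝ (K : Set E3) ↔ ∀ v ∈ K, 0 ≤ baryCoord K v x := by
  have := (tetBasis hK hc).convexHull_eq_nonneg_coord
  rw [range_tetBasis] at this
  rw [this]
  simp only [Set.mem_ofPred_eq, tetBasis_coord, Subtype.forall]

lemma mem_interior_convexHull_tet_iff (hK : AffineIndependent ℝ ((↑) : K → E3)) (hc : K.card = 4)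
    {x : E3} :
    x ∈ interior (convexHull ℝ (K : Set E3)) ↔ ∀ v ∈ K, 0 < baryCoord K v x := by
  have := (tetBasis hK hc).interior_convexHull
  rw [range_tetBasis] at this
  rw [this]
  simp only [Set.mem_ofPred_eq, tetBasis_coord, Subtype.forall]

lemma continuous_baryCoord (K : Finset E3) (v : E3) : Continuous (baryCoord K v) :=
  (IsPolyFn.affine _).continuous

lemma isCompact_convexHull_finset (K : Finset E3) : IsCompact (convexHull ℝ (K : Set E3)) :=
  K.finite_toSet.isCompact_convexHull (𝕜 := ℝ)

lemma interior_convexHull_tet_nonempty (hK : AffineIndependent ℝ ((↑) : K → E3))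
    (hc : K.card = 4) : (interior (convexHull ℝ (K : Set E3))).Nonempty := by
  rw [interior_convexHull_nonempty_iff_affineSpan_eq_top]
  simpa using affineSpan_tet hK hc

lemma volume_real_convexHull_pos (hK : AffineIndependent ℝ ((↑) : K → E3)) (hc : K.card = 4) :
    0 < volume.real (convexHull ℝ (K : Set E3)) := by
  refine ENNReal.toReal_pos ?_ (isCompact_convexHull_finset K).measure_lt_top.ne
  exact (Measure.measure_pos_of_nonempty_interior _ (interior_convexHull_tet_nonempty hK hc)).ne'

lemma interior_ae_eq_convexHull (K : Finset E3) :
    interior (convexHull ℝ (K : Set E3)) =ᵐ[volume] convexHull ℝ (K : Set E3) :=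
  interior_ae_eq_of_null_frontier ((convex_convexHull ℝ _).addHaar_frontier volume)

lemma sum_baryCoord_linear (hK : AffineIndependent ℝ ((↑) : K → E3)) (hc : K.card = 4) (y : E3) :
    ∑ v ∈ K, (baryCoord K v).linear y = 0 := by
  have h : ∀ v, (baryCoord K v).linear y = baryCoord K v y - baryCoord K v 0 := by
    intro v
    have := (baryCoord K v).linearMap_vsub y 0
    simpa using this
  simp_rw [h, Finset.sum_sub_distrib, sum_baryCoord_eq_one hK hc, sub_self]

/-- The Jacobi polynomial in the barycentric coordinate of the vertex `p` reproduces, up to a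
constant, the value in `p`. -/
lemma integral_tet_jacobiPoly (hK : AffineIndependent ℝ ((↑) : K → E3)) (hc : K.card = 4)
    {p : E3} (hp : p ∈ K) {n : ℕ} {g : E3 → ℝ} (hg : IsPolyFn n g) :
    ∫ x in convexHull ℝ (K : Set E3), (jacobiPoly 0 3 n).eval (1 - 2 * baryCoord K p x) * g x =
      jacobiMean n * volume.real (convexHull ℝ (K : Set E3)) * g p := by
  obtain ⟨hp1, hp0⟩ := baryCoord_spec hK hc hp
  -- Move `p` to the origin: `C` is the cone spanned by `K` at `p`, and `s` is `1 - λ_p`, so that `1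
  -- - 2λ_p = 2s - 1` and the facet opposite to `p` is `s = 1`.
  set C : Set E3 := {y | ∀ v ∈ K, v ≠ p → 0 ≤ (baryCoord K v).linear y} with hC
  set s : E3 →ₗ[ℝ] ℝ := -(baryCoord K p).linear with hs
  have hlin : ∀ v y, baryCoord K v (p + y) = (baryCoord K v).linear y + baryCoord K v p := by
    intro v y
    have := (baryCoord K v).map_vadd p y
    simpa [add_comm] using this
  have hs' : ∀ y, s y = 1 - baryCoord K p (p + y) := by
    intro y; simp [hs, hlin, hp1]
  have hpre : (fun y => p + y) ⁻¹' convexHull ℝ (K : Set E3) = {y | y ∈ C ∧ s y ≤ 1} := by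
    ext y
    simp only [Set.mem_preimage, mem_convexHull_tet_iff hK hc, Set.mem_ofPred_eq, hs', hC]
    constructor
    · intro h
      refine ⟨fun v hv hvp => ?_, by linarith [h p hp]⟩
      have := h v hv
      rwa [hlin, (baryCoord_spec hK hc hv).2 p hp (Ne.symm hvp), add_zero] at this
    · rintro ⟨h1, h2⟩ v hv
      by_cases hvp : v = p
      · subst hvp; linarith
      · rw [hlin, (baryCoord_spec hK hc hv).2 p hp (Ne.symm hvp), add_zero]
        exact h1 v hv hvp
  have hmp : MeasurePreserving (fun y => p + y) (volume : Measure E3) volume :=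
    measurePreserving_add_left volume p
  have hemb : MeasurableEmbedding (fun y : E3 => p + y) := measurableEmbedding_addLeft p
  have hcomp : IsCompact {y | y ∈ C ∧ s y ≤ 1} := by
    rw [← hpre]
    exact (Homeomorph.addLeft p).isCompact_preimage.2 (isCompact_convexHull_finset K)
  have hsC : ∀ y ∈ C, 0 ≤ s y := by
    intro y hy
    have h1 := sum_baryCoord_linear hK hc y
    rw [← Finset.add_sum_erase _ _ hp] at h1
    have h2 : 0 ≤ ∑ v ∈ K.erase p, (baryCoord K v).linear y :=
      Finset.sum_nonneg fun v hv => hy v (Finset.mem_of_mem_erase hv) (Finset.ne_of_mem_erase hv)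
    simp only [hs, LinearMap.neg_apply]
    linarith
  have hcone : ∀ r : ℝ, 0 < r → ∀ y ∈ C, r • y ∈ C := by
    intro r hr y hy v hv hvp
    rw [map_smul]
    exact mul_nonneg hr.le (hy v hv hvp)
  have main := integral_truncatedCone_jacobiPoly s hsC hcone hcomp (hg.translate p)
  rw [← hpre, add_zero] at main
  rw [← hmp.setIntegral_preimage_emb hemb]
  have hv : volume.real ((fun y => p + y) ⁻¹' convexHull ℝ (K : Set E3)) =
      volume.real (convexHull ℝ (K : Set E3)) := by
    rw [Measure.real, hmp.measure_preimage_emb hemb, Measure.real]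
  rw [hv] at main
  rw [← main]
  congr 1
  ext y
  rw [hs']
  congr 2
  ring

end Tet

section Mesh

open Geometry

variable {T : SimplicialComplex ℝ E3} {E K K' : Finset E3}

/-! ### Local structure of tetrahedral meshes -/

/-- By conformity `x` lies in the hull of the common vertices, where `λ_v` would be non-positive if
`v` were not one of them. This is the tool that turns positions of points into incidences. -/
lemma mem_of_baryCoord_pos (hK : K ∈ tets T) (hK' : K' ∈ T.faces) {x : E3}
    (hx : x ∈ convexHull ℝ (K : Set E3)) (hx' : x ∈ convexHull ℝ (K' : Set E3)) {v : E3}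
    (hv : v ∈ K) (h : 0 < baryCoord K v x) : v ∈ K' := by
  by_contra hv'
  have h1 := T.inter_subset_convexHull hK.1 hK' ⟨hx, hx'⟩
  have h2 : convexHull ℝ (K ∩ K' : Set E3) ⊆ {y | baryCoord K v y ≤ 0} := by
    refine convexHull_min ?_ ((convex_Iic (0 : ℝ)).affine_preimage (baryCoord K v))
    rintro y ⟨hy, hy'⟩
    exact ((baryCoord_spec (T.indep hK.1) hK.2 hv).2 y hy (by rintro rfl; exact hv' hy')).le
  exact absurd (h2 h1) (not_le.2 h)

lemma IsTetMesh.finite_tets (hT : IsTetMesh T) : (tets T).Finite :=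
  hT.1.subset fun _ h => h.1

lemma isOpen_dom (T : SimplicialComplex ℝ E3) : IsOpen (dom T) := isOpen_interior

lemma interior_tet_subset_dom (hK : K ∈ tets T) :
    interior (convexHull ℝ (K : Set E3)) ⊆ dom T :=
  interior_mono (Set.subset_biUnion_of_mem (u := fun K : Finset E3 => convexHull ℝ (K : Set E3)) hK)

lemma convexHull_subset_closure_dom (hK : K ∈ tets T) :
    convexHull ℝ (K : Set E3) ⊆ closure (dom T) := by
  have h := (convex_convexHull ℝ (K : Set E3)).closure_interior_eq_closure_of_nonempty_interior
    (interior_convexHull_tet_nonempty (T.indep hK.1) hK.2)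
  exact subset_closure.trans (h.symm.subset.trans (closure_mono (interior_tet_subset_dom hK)))

/-- Finitely many closed tetrahedra: those missing `x` also miss a neighbourhood of `x`. -/
lemma eventually_mem_convexHull_imp (hT : IsTetMesh T) (x : E3) :
    ∀ᶠ y in nhds x, ∀ K ∈ tets T, y ∈ convexHull ℝ (K : Set E3) → x ∈ convexHull ℝ (K : Set E3) := by
  rw [Filter.eventually_all_finite hT.finite_tets]
  intro K _
  by_cases hx : x ∈ convexHull ℝ (K : Set E3)
  · simp [hx]
  · filter_upwards [(isCompact_convexHull_finset K).isClosed.isOpen_compl.mem_nhds hx] with y hy h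
    exact absurd h hy

lemma eventually_exists_tet_of_mem_dom (hT : IsTetMesh T) {x : E3} (hx : x ∈ dom T) :
    ∀ᶠ y in nhds x, ∃ K ∈ tets T, x ∈ convexHull ℝ (K : Set E3) ∧ y ∈ convexHull ℝ (K : Set E3) := by
  filter_upwards [eventually_mem_convexHull_imp hT x, (isOpen_dom T).mem_nhds hx] with y h hy
  obtain ⟨K, hK, hyK⟩ := Set.mem_iUnion₂.1 (interior_subset hy)
  exact ⟨K, hK, h K hK hyK, hyK⟩

/-! ### Frames of critical edges -/

/-- A non-degenerate triangle in a plane has the full direction space of that plane. -/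
lemma IsPlane.affine_eq_zero {P : AffineSubspace ℝ E3} (hP : IsPlane P) {F : Finset E3}
    (hF : F ∈ triangles T) (hFP : (F : Set E3) ⊆ P) {f : E3 →ᵃ[ℝ] ℝ} (hf : ∀ x ∈ F, f x = 0)
    {x : E3} (hx : x ∈ P) : f x = 0 := by
  obtain ⟨z, hz⟩ := T.nonempty_of_mem_faces hF.1
  have h1 : Module.finrank ℝ (vectorSpan ℝ (F : Set E3)) = 2 := by
    have := (T.indep hF.1).finrank_vectorSpan (n := 2) (by simpa using hF.2)
    rwa [show Set.range ((↑) : F → E3) = (F : Set E3) from Subtype.range_coe] at this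
  have h2 : vectorSpan ℝ (F : Set E3) ≤ P.direction := by
    rw [AffineSubspace.direction_eq_vectorSpan]
    exact vectorSpan_mono ℝ hFP
  have h3 : vectorSpan ℝ (F : Set E3) = P.direction :=
    Submodule.eq_of_le_of_finrank_eq h2 (h1.trans hP.2.symm)
  have h4 : vectorSpan ℝ (F : Set E3) ≤ LinearMap.ker f.linear := by
    rw [vectorSpan_def, Submodule.span_le]
    rintro _ ⟨a, ha, b, hb, rfl⟩
    simp only [SetLike.mem_coe, LinearMap.mem_ker]
    rw [AffineMap.linearMap_vsub, hf a ha, hf b hb]; simp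
  have h5 : x -ᵥ z ∈ P.direction := AffineSubspace.vsub_mem_direction hx (hFP hz)
  have h6 : f.linear (x -ᵥ z) = 0 := h4 (h3 ▸ h5)
  rw [AffineMap.linearMap_vsub, hf z hz] at h6
  simpa using h6

/-- Coordinates of a critical edge: the affine functions `α` and `β` vanish on the edge, and every
tetrahedron of the edge patch has, besides the edge, one vertex `cv` on the plane `P`, where `β`
vanishes, and one vertex `dv` on the plane `Q`, where `α` vanishes. -/
structure EdgeFrame (T : SimplicialComplex ℝ E3) (E : Finset E3) where
  (α β : E3 →ᵃ[ℝ] ℝ)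
  (P Q : AffineSubspace ℝ E3)
  (cv dv : Finset E3 → E3)
  mesh : IsTetMesh T
  edge : E ∈ edges T
  isPlane_P : IsPlane P
  isPlane_Q : IsPlane Q
  P_ne_Q : P ≠ Q
  edge_subset_P : (E : Set E3) ⊆ P
  edge_subset_Q : (E : Set E3) ⊆ Q
  α_edge : ∀ e ∈ E, α e = 0
  β_edge : ∀ e ∈ E, β e = 0
  cv_mem : ∀ K ∈ edgePatch T E, cv K ∈ K
  dv_mem : ∀ K ∈ edgePatch T E, dv K ∈ K
  cv_mem_P : ∀ K ∈ edgePatch T E, cv K ∈ P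
  dv_mem_Q : ∀ K ∈ edgePatch T E, dv K ∈ Q
  α_cv : ∀ K ∈ edgePatch T E, α (cv K) ≠ 0
  β_cv : ∀ K ∈ edgePatch T E, β (cv K) = 0
  α_dv : ∀ K ∈ edgePatch T E, α (dv K) = 0
  β_dv : ∀ K ∈ edgePatch T E, β (dv K) ≠ 0

lemma edgePatch_nonempty (hT : IsTetMesh T) (hE : E ∈ edges T) : (edgePatch T E).Nonempty := by
  obtain ⟨K, hK, hEK, hc⟩ := hT.2 E hE.1
  exact ⟨K, ⟨hK, hc⟩, hEK⟩

lemma exists_opposite_vertices (hE : E ∈ edges T) (hK : K ∈ edgePatch T E) :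
    ∃ c d, c ∈ K ∧ d ∈ K ∧ c ∉ E ∧ d ∉ E ∧ c ≠ d := by
  classical
  have h : (K \ E).card = 2 := by
    rw [Finset.card_sdiff_of_subset hK.2, hK.1.2, hE.2]
  obtain ⟨c, d, hcd, h⟩ := Finset.card_eq_two.1 h
  have hc : c ∈ K \ E := by simp [h]
  have hd : d ∈ K \ E := by simp [h]
  rw [Finset.mem_sdiff] at hc hd
  exact ⟨c, d, hc.1, hd.1, hc.2, hd.2, hcd⟩

lemma insert_mem_triangles [DecidableEq E3] (hE : E ∈ edges T) (hK : K ∈ edgePatch T E) {c : E3}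
    (hc : c ∈ K) (hcE : c ∉ E) : insert c E ∈ triangles T := by
  refine ⟨T.down_closed hK.1.1 (Finset.insert_subset hc hK.2) (Finset.insert_nonempty _ _), ?_⟩
  rw [Finset.card_insert_of_notMem hcE, hE.2]

/-- Otherwise `λ_d`, which vanishes on the triangle of `E` and `c`, would vanish on the whole plane
and hence at `d`. -/
lemma IsPlane.not_mem_both (hE : E ∈ edges T) (hK : K ∈ edgePatch T E) {c d : E3}
    (hc : c ∈ K) (hd : d ∈ K) (hcE : c ∉ E) (hdE : d ∉ E) (hcd : c ≠ d)
    {P : AffineSubspace ℝ E3} (hP : IsPlane P) (hEP : (E : Set E3) ⊆ P) (hcP : c ∈ P) : d ∉ P := by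
  classical
  intro hdP
  obtain ⟨h1, h0⟩ := baryCoord_spec (T.indep hK.1.1) hK.1.2 hd
  have := hP.affine_eq_zero (insert_mem_triangles hE hK hc hcE)
    (by rw [Finset.coe_insert]; exact Set.insert_subset hcP hEP) (f := baryCoord K d) (by
      intro x hx
      rcases Finset.mem_insert.1 hx with rfl | hx
      · exact h0 _ hc hcd
      · exact h0 _ (hK.2 hx) (by rintro rfl; exact hdE hx)) hdP
  rw [h1] at this
  exact one_ne_zero this

/-- The two vertices of a patch tetrahedron off `E` cannot lie in the same plane, so there is one in
each. The functions `α, β` are the barycentric coordinates of these two vertices in one fixed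
tetrahedron `K₀`. -/
lemma exists_edgeFrame (hT : IsTetMesh T) (hE : IsCriticalEdge T E) : Nonempty (EdgeFrame T E) := by
  classical
  obtain ⟨hE, P₀, Q₀, hP₀, hQ₀, hF₀⟩ := hE
  have hF : ∀ K ∈ edgePatch T E, ∀ c ∈ K, c ∉ E →
      ((E : Set E3) ⊆ P₀ ∧ c ∈ P₀) ∨ ((E : Set E3) ⊆ Q₀ ∧ c ∈ Q₀) := by
    intro K hK c hc hcE
    have h : ∀ R : AffineSubspace ℝ E3, convexHull ℝ ((insert c E : Finset E3) : Set E3) ⊆ R →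
        (E : Set E3) ⊆ R ∧ c ∈ R := by
      intro R hR
      have := (subset_convexHull ℝ _).trans hR
      rw [Finset.coe_insert, Set.insert_subset_iff] at this
      exact ⟨this.2, this.1⟩
    exact (hF₀ _ (insert_mem_triangles hE hK hc hcE) (Finset.subset_insert _ _)).imp (h P₀) (h Q₀)
  obtain ⟨K₀, hK₀⟩ := edgePatch_nonempty hT hE
  obtain ⟨a, b, ha, hb, haE, hbE, hab⟩ := exists_opposite_vertices hE hK₀
  -- choose the order of the two planes
  obtain ⟨P, Q, hP, hQ, hEP, hEQ, haP, hbQ, hF⟩ : ∃ P Q : AffineSubspace ℝ E3, IsPlane P ∧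
      IsPlane Q ∧ (E : Set E3) ⊆ P ∧ (E : Set E3) ⊆ Q ∧ a ∈ P ∧ b ∈ Q ∧
      ∀ K ∈ edgePatch T E, ∀ c ∈ K, c ∉ E → c ∈ P ∨ c ∈ Q := by
    rcases hF K₀ hK₀ a ha haE with ⟨hEP, haP⟩ | ⟨hEP, haP⟩ <;>
      rcases hF K₀ hK₀ b hb hbE with ⟨hEQ, hbQ⟩ | ⟨hEQ, hbQ⟩
    · exact absurd hbQ (hP₀.not_mem_both hE hK₀ ha hb haE hbE hab hEP haP)
    · exact ⟨P₀, Q₀, hP₀, hQ₀, hEP, hEQ, haP, hbQ,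
        fun K hK c hc hcE => (hF K hK c hc hcE).imp And.right And.right⟩
    · exact ⟨Q₀, P₀, hQ₀, hP₀, hEP, hEQ, haP, hbQ,
        fun K hK c hc hcE => (hF K hK c hc hcE).symm.imp And.right And.right⟩
    · exact absurd hbQ (hQ₀.not_mem_both hE hK₀ ha hb haE hbE hab hEP haP)
  have hv : ∀ K ∈ edgePatch T E, ∃ c d, c ∈ K ∧ d ∈ K ∧ c ∉ E ∧ d ∉ E ∧ c ∈ P ∧ d ∈ Q := by
    intro K hK
    obtain ⟨c, d, hc, hd, hcE, hdE, hcd⟩ := exists_opposite_vertices hE hK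
    rcases hF K hK c hc hcE with h | h <;> rcases hF K hK d hd hdE with h' | h'
    · exact absurd h' (hP.not_mem_both hE hK hc hd hcE hdE hcd hEP h)
    · exact ⟨c, d, hc, hd, hcE, hdE, h, h'⟩
    · exact ⟨d, c, hd, hc, hdE, hcE, h', h⟩
    · exact absurd h' (hQ.not_mem_both hE hK hc hd hcE hdE hcd hEQ h)
  choose! cv dv hcK hdK hcE hdE hcP hdQ using hv
  obtain ⟨ha1, ha0⟩ := baryCoord_spec (T.indep hK₀.1.1) hK₀.1.2 ha
  obtain ⟨hb1, hb0⟩ := baryCoord_spec (T.indep hK₀.1.1) hK₀.1.2 hb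
  have hαE : ∀ e ∈ E, baryCoord K₀ a e = 0 := fun e he =>
    ha0 e (hK₀.2 he) (by rintro rfl; exact haE he)
  have hβE : ∀ e ∈ E, baryCoord K₀ b e = 0 := fun e he =>
    hb0 e (hK₀.2 he) (by rintro rfl; exact hbE he)
  have hvan : ∀ {R : AffineSubspace ℝ E3} (_ : IsPlane R) (_ : (E : Set E3) ⊆ R) {K : Finset E3}
      (_ : K ∈ edgePatch T E) {c : E3} (_ : c ∈ K) (_ : c ∉ E) (_ : c ∈ R) {f : E3 →ᵃ[ℝ] ℝ}
      (_ : ∀ e ∈ E, f e = 0) (_ : f c = 0) {x : E3} (_ : x ∈ R), f x = 0 := by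
    intro R hR hER K hK c hc hcE hcR f hf hfc x hx
    refine hR.affine_eq_zero (insert_mem_triangles hE hK hc hcE) ?_ (f := f) ?_ hx
    · rw [Finset.coe_insert]; exact Set.insert_subset hcR hER
    · intro y hy
      rcases Finset.mem_insert.1 hy with rfl | hy
      exacts [hfc, hf y hy]
  have hβP : ∀ x ∈ P, baryCoord K₀ b x = 0 := fun x hx =>
    hvan hP hEP hK₀ ha haE haP hβE (hb0 a ha hab) hx
  have hαQ : ∀ x ∈ Q, baryCoord K₀ a x = 0 := fun x hx =>
    hvan hQ hEQ hK₀ hb hbE hbQ hαE (ha0 b hb hab.symm) hx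
  exact ⟨{
    α := baryCoord K₀ a
    β := baryCoord K₀ b
    P := P
    Q := Q
    cv := cv
    dv := dv
    mesh := hT
    edge := hE
    isPlane_P := hP
    isPlane_Q := hQ
    P_ne_Q := by
      rintro rfl
      exact one_ne_zero (hb1.symm.trans (hβP b hbQ))
    edge_subset_P := hEP
    edge_subset_Q := hEQ
    α_edge := hαE
    β_edge := hβE
    cv_mem := hcK
    dv_mem := hdK
    cv_mem_P := hcP
    dv_mem_Q := hdQ
    -- If `α` vanished at a further vertex in `P`, it would vanish on all of `P`, although it is `1`
    -- at `a`.
    α_cv := fun K hK h => one_ne_zero (α := ℝ) (ha1.symm.trans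
      (hvan hP hEP hK (hcK K hK) (hcE K hK) (hcP K hK) hαE h haP))
    β_cv := fun K hK => hβP _ (hcP K hK)
    α_dv := fun K hK => hαQ _ (hdQ K hK)
    β_dv := fun K hK h => one_ne_zero (α := ℝ) (hb1.symm.trans
      (hvan hQ hEQ hK (hdK K hK) (hdE K hK) (hdQ K hK) hβE h hbQ)) }⟩

namespace EdgeFrame

variable (F : EdgeFrame T E)

/-- The frame with the roles of the two planes exchanged. -/
def swap : EdgeFrame T E where
  α := F.β
  β := F.α
  P := F.Q
  Q := F.P
  cv := F.dv
  dv := F.cv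
  mesh := F.mesh
  edge := F.edge
  isPlane_P := F.isPlane_Q
  isPlane_Q := F.isPlane_P
  P_ne_Q := F.P_ne_Q.symm
  edge_subset_P := F.edge_subset_Q
  edge_subset_Q := F.edge_subset_P
  α_edge := F.β_edge
  β_edge := F.α_edge
  cv_mem := F.dv_mem
  dv_mem := F.cv_mem
  cv_mem_P := F.dv_mem_Q
  dv_mem_Q := F.cv_mem_P
  α_cv := F.β_dv
  β_cv := F.α_dv
  α_dv := F.β_cv
  β_dv := F.α_cv

variable {F}

lemma cv_notMem (hK : K ∈ edgePatch T E) : F.cv K ∉ E := fun h => F.α_cv K hK (F.α_edge _ h)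

lemma dv_notMem (hK : K ∈ edgePatch T E) : F.dv K ∉ E := F.swap.cv_notMem hK

lemma cv_ne_dv (hK : K ∈ edgePatch T E) : F.cv K ≠ F.dv K := fun h =>
  F.α_cv K hK (h ▸ F.α_dv K hK)

lemma mem_iff (hK : K ∈ edgePatch T E) {x : E3} : x ∈ K ↔ x = F.cv K ∨ x = F.dv K ∨ x ∈ E := by
  classical
  have h : insert (F.cv K) (insert (F.dv K) E) = K := by
    refine Finset.eq_of_subset_of_card_le ?_ ?_
    · exact Finset.insert_subset (F.cv_mem K hK) (Finset.insert_subset (F.dv_mem K hK) hK.2)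
    · rw [Finset.card_insert_of_notMem, Finset.card_insert_of_notMem (dv_notMem hK), hK.1.2, F.edge.2]
      simp [cv_ne_dv hK, cv_notMem hK]
  rw [← Finset.mem_insert, ← Finset.mem_insert, h]

/-- The same function `α` serves all tetrahedra of the patch, up to scaling; this makes their
positions comparable. -/
lemma baryCoord_cv (hK : K ∈ edgePatch T E) (x : E3) :
    baryCoord K (F.cv K) x = F.α x / F.α (F.cv K) := by
  have h : (F.α (F.cv K))⁻¹ • F.α = baryCoord K (F.cv K) := by
    refine baryCoord_unique (T.indep hK.1.1) hK.1.2 (F.cv_mem K hK) _ ?_ ?_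
    · simp [F.α_cv K hK]
    · intro y hy hyc
      rcases (mem_iff (F := F) hK).1 hy with rfl | rfl | hy
      · exact absurd rfl hyc
      · simp [F.α_dv K hK]
      · simp [F.α_edge y hy]
  rw [← h]
  simp [div_eq_inv_mul]

lemma baryCoord_dv (hK : K ∈ edgePatch T E) (x : E3) :
    baryCoord K (F.dv K) x = F.β x / F.β (F.dv K) := F.swap.baryCoord_cv hK x

/-- On the relatively open edge the barycentric coordinates of its end points are positive. -/
lemma baryCoord_pos_of_mem_openSegment (hK : K ∈ edgePatch T E) {p q m : E3} (hpq : E = {p, q})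
    (hne : p ≠ q) (hm : m ∈ openSegment ℝ p q) : ∀ e ∈ E, 0 < baryCoord K e m := by
  classical
  have key : ∀ {p q : E3}, p ∈ K → q ∈ K → p ≠ q → m ∈ openSegment ℝ p q → 0 < baryCoord K p m := by
    intro p q hp hq hne hm
    obtain ⟨s, t, hs, ht, hst, rfl⟩ := hm
    obtain ⟨h1, h0⟩ := baryCoord_spec (T.indep hK.1.1) hK.1.2 hp
    rw [Convex.combo_affine_apply hst, h1, h0 q hq hne.symm]
    simpa using hs
  have hp : p ∈ K := hK.2 (by simp [hpq])
  have hq : q ∈ K := hK.2 (by simp [hpq])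
  intro e he
  rw [hpq] at he
  rcases Finset.mem_insert.1 he with rfl | he
  · exact key hp hq hne hm
  · rw [Finset.mem_singleton.1 he]
    exact key hq hp hne.symm (openSegment_symm ℝ p q ▸ hm)

lemma α_openSegment {p q m : E3} (F : EdgeFrame T E) (hp : p ∈ E) (hq : q ∈ E)
    (hm : m ∈ openSegment ℝ p q) : F.α m = 0 := by
  obtain ⟨s, t, hs, ht, hst, rfl⟩ := hm
  rw [Convex.combo_affine_apply hst, F.α_edge p hp, F.α_edge q hq]
  simp

/-- Near a relative interior point of the edge the two coordinates belonging to `E` stay positive,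
so the tetrahedron looks like a closed wedge. -/
lemma eventually_mem_iff (F : EdgeFrame T E) (hK : K ∈ edgePatch T E) {m : E3}
    (hm : ∀ e ∈ E, 0 < baryCoord K e m) :
    ∀ᶠ x in nhds m, (x ∈ convexHull ℝ (K : Set E3) ↔
      0 ≤ F.α x / F.α (F.cv K) ∧ 0 ≤ F.β x / F.β (F.dv K)) := by
  have h : ∀ᶠ x in nhds m, ∀ e ∈ E, 0 < baryCoord K e x := by
    rw [Filter.eventually_all_finset]
    exact fun e he => (continuous_baryCoord K e).continuousAt.eventually_const_lt (hm e he)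
  filter_upwards [h] with x hx
  rw [mem_convexHull_tet_iff (T.indep hK.1.1) hK.1.2]
  constructor
  · intro h
    rw [← baryCoord_cv hK, ← baryCoord_dv hK]
    exact ⟨h _ (F.cv_mem K hK), h _ (F.dv_mem K hK)⟩
  · rintro ⟨h1, h2⟩ v hv
    rcases (mem_iff (F := F) hK).1 hv with rfl | rfl | hv
    · rwa [baryCoord_cv hK]
    · rwa [baryCoord_dv hK]
    · exact (hx v hv).le

/-- The two coordinates of a frame are independent. -/
lemma exists_linear_eq (F : EdgeFrame T E) (x y : ℝ) :
    ∃ w : E3, F.α.linear w = x ∧ F.β.linear w = y := by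
  obtain ⟨K, hK⟩ := edgePatch_nonempty F.mesh F.edge
  obtain ⟨e, he⟩ := T.nonempty_of_mem_faces F.edge.1
  have hl : ∀ (f : E3 →ᵃ[ℝ] ℝ) (z : E3), f e = 0 → f.linear (z - e) = f z := by
    intro f z hf
    have := f.linearMap_vsub z e
    simpa [hf] using this
  have h1 := F.α_cv K hK
  have h2 := F.β_dv K hK
  refine ⟨(x / F.α (F.cv K)) • (F.cv K - e) + (y / F.β (F.dv K)) • (F.dv K - e), ?_, ?_⟩
  · simp only [map_add, map_smul, hl _ _ (F.α_edge e he), F.α_dv K hK, smul_eq_mul]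
    field_simp; simp
  · simp only [map_add, map_smul, hl _ _ (F.β_edge e he), F.β_cv K hK, smul_eq_mul]
    field_simp; simp

/-- In the barycentric expansion of `z - e`, the vertices of `E` contribute nothing, and the other
two coordinates are multiples of `α` and `β`. -/
lemma exists_eq_add_of_edge (F : EdgeFrame T E) (S : E3 →ₗ[ℝ] ℝ)
    (hS : ∀ e ∈ E, ∀ e' ∈ E, S (e - e') = 0) :
    ∃ A B : ℝ, S = A • F.α.linear + B • F.β.linear := by
  classical
  obtain ⟨K, hK⟩ := edgePatch_nonempty F.mesh F.edge
  obtain ⟨e, he⟩ := T.nonempty_of_mem_faces F.edge.1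
  have hl : ∀ (f : E3 →ᵃ[ℝ] ℝ) (z : E3), f e = 0 → f.linear (z - e) = f z := by
    intro f z hf
    have := f.linearMap_vsub z e
    simpa [hf] using this
  have h1 := F.α_cv K hK
  have h2 := F.β_dv K hK
  refine ⟨S (F.cv K - e) / F.α (F.cv K), S (F.dv K - e) / F.β (F.dv K), ?_⟩
  have key : ∀ z, S (z - e) = S (F.cv K - e) / F.α (F.cv K) * F.α z +
      S (F.dv K - e) / F.β (F.dv K) * F.β z := by
    intro z
    have hz : z - e = ∑ v ∈ K, baryCoord K v z • (v - e) := by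
      simp_rw [smul_sub, Finset.sum_sub_distrib, sum_baryCoord_smul_eq (T.indep hK.1.1) hK.1.2,
        ← Finset.sum_smul, sum_baryCoord_eq_one (T.indep hK.1.1) hK.1.2, one_smul]
    have hsub : {F.cv K, F.dv K} ⊆ K := by
      simp [Finset.insert_subset_iff, F.cv_mem K hK, F.dv_mem K hK]
    rw [hz, map_sum, ← Finset.sum_subset hsub, Finset.sum_pair (cv_ne_dv hK)]
    · simp only [map_smul, smul_eq_mul, baryCoord_cv hK, baryCoord_dv hK]
      ring
    · intro v hv hv'
      rcases (mem_iff (F := F) hK).1 hv with rfl | rfl | hv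
      · simp at hv'
      · simp at hv'
      · rw [map_smul, hS v hv e he, smul_zero]
  ext w
  have := key (e + w)
  rw [add_sub_cancel_left] at this
  rw [this, ← hl F.α (e + w) (F.α_edge e he), ← hl F.β (e + w) (F.β_edge e he), add_sub_cancel_left]
  rfl

/-- The wedge of a tetrahedron of the edge patch, given by the signs of `α` and `β`. -/
noncomputable def sgn (F : EdgeFrame T E) (K : Finset E3) : Bool × Bool :=
  (decide (0 < F.α (F.cv K)), decide (0 < F.β (F.dv K)))

lemma exists_edge (F : EdgeFrame T E) : ∃ p q : E3, p ≠ q ∧ E = {p, q} := by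
  classical
  exact Finset.card_eq_two.1 F.edge.2

/-- A short step from the midpoint of the edge, with `β` kept at `0` and `α` moved towards its value
at `cv K`, stays in both wedges. There the coordinate of `cv K` is positive, so `cv K` is a vertex
of `K'`. -/
lemma cv_eq_of_sgn_eq (hK : K ∈ edgePatch T E) (hK' : K' ∈ edgePatch T E)
    (h : (F.sgn K).1 = (F.sgn K').1) : F.cv K = F.cv K' := by
  obtain ⟨p, q, hne, hpq⟩ := F.exists_edge
  have hm : midpoint ℝ p q ∈ openSegment ℝ p q := midpoint_mem_openSegment p q
  set m := midpoint ℝ p q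
  have hα : F.α m = 0 := F.α_openSegment (by simp [hpq]) (by simp [hpq]) hm
  have hβ : F.β m = 0 := F.swap.α_openSegment (by simp [hpq]) (by simp [hpq]) hm
  obtain ⟨w, hw1, hw2⟩ := F.exists_linear_eq (F.α (F.cv K)) 0
  have hc : Filter.Tendsto (fun t : ℝ => m + t • w) (nhdsWithin 0 (Set.Ioi 0)) (nhds m) := by
    have : Continuous fun t : ℝ => m + t • w := by fun_prop
    have := this.tendsto 0
    simp only [zero_smul, add_zero] at this
    exact this.mono_left nhdsWithin_le_nhds
  have e1 := hc.eventually (F.eventually_mem_iff hK (baryCoord_pos_of_mem_openSegment hK hpq hne hm))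
  have e2 := hc.eventually
    (F.eventually_mem_iff hK' (baryCoord_pos_of_mem_openSegment hK' hpq hne hm))
  obtain ⟨t, ⟨h1, h2⟩, ht⟩ := ((e1.and e2).and self_mem_nhdsWithin).exists
  have ht : 0 < t := ht
  have hαt : F.α (m + t • w) = t * F.α (F.cv K) := by
    have := F.α.map_vadd m (t • w)
    simp only [vadd_eq_add, map_smul, hα, hw1, smul_eq_mul, add_zero] at this
    rw [add_comm, this]
  have hβt : F.β (m + t • w) = 0 := by
    have := F.β.map_vadd m (t • w)
    simp only [vadd_eq_add, map_smul, hβ, hw2, smul_eq_mul, add_zero, mul_zero] at this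
    rw [add_comm, this]
  have hK0 := F.α_cv K hK
  have hK0' := F.α_cv K' hK'
  have hpos : 0 < F.α (m + t • w) / F.α (F.cv K) := by
    rw [hαt, mul_div_assoc, div_self hK0, mul_one]; exact ht
  have hpos' : 0 ≤ F.α (m + t • w) / F.α (F.cv K') := by
    rw [hαt]
    simp only [sgn, decide_eq_decide] at h
    rcases lt_or_gt_of_ne hK0 with hn | hn
    · have : F.α (F.cv K') ≤ 0 := not_lt.1 (mt h.2 hn.not_gt)
      exact div_nonneg_of_nonpos (mul_nonpos_of_nonneg_of_nonpos ht.le hn.le) this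
    · exact div_nonneg (by positivity) (h.1 hn).le
  have m1 := h1.2 ⟨hpos.le, by simp [hβt]⟩
  have m2 := h2.2 ⟨hpos', by simp [hβt]⟩
  have := mem_of_baryCoord_pos hK.1 hK'.1.1 m1 m2 (F.cv_mem K hK) (by rwa [baryCoord_cv hK])
  rcases (mem_iff (F := F) hK').1 this with h3 | h3 | h3
  · exact h3
  · exact absurd (h3 ▸ F.α_dv K' hK') hK0
  · exact absurd h3 (cv_notMem hK)

lemma dv_eq_of_sgn_eq (hK : K ∈ edgePatch T E) (hK' : K' ∈ edgePatch T E)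
    (h : (F.sgn K).2 = (F.sgn K').2) : F.dv K = F.dv K' :=
  F.swap.cv_eq_of_sgn_eq hK hK' h

lemma eq_of_sgn_eq (hK : K ∈ edgePatch T E) (hK' : K' ∈ edgePatch T E)
    (h : F.sgn K = F.sgn K') : K = K' := by
  ext x
  rw [mem_iff (F := F) hK, mem_iff (F := F) hK', cv_eq_of_sgn_eq hK hK' (by rw [h]),
    dv_eq_of_sgn_eq hK hK' (by rw [h])]

lemma sgn_fst_eq_of_cv_eq (h : F.cv K = F.cv K') : (F.sgn K).1 = (F.sgn K').1 := by
  simp [sgn, h]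

lemma mem_edgePatch_of_mem (hK : K ∈ edgePatch T E) {K' : Finset E3} (hK' : K' ∈ tets T) {x : E3}
    (hx : x ∈ convexHull ℝ (K : Set E3)) (hx' : x ∈ convexHull ℝ (K' : Set E3))
    (h : ∀ e ∈ E, 0 < baryCoord K e x) : K' ∈ edgePatch T E :=
  ⟨hK', fun e he => mem_of_baryCoord_pos hK.1 hK'.1 hx hx' (hK.2 he) (h e he)⟩

/-- A small step from `m` into the prescribed wedge remains in some tetrahedron containing `m`. It
contains `E`, because `m` is interior to the edge, and its signs are forced by the position of the
new point. -/
lemma exists_sgn_eq_of_mem_dom (F : EdgeFrame T E) {p q m : E3} (hpq : E = {p, q}) (hne : p ≠ q)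
    (hm : m ∈ openSegment ℝ p q) (hmd : m ∈ dom T) (s : Bool × Bool) :
    ∃ K ∈ edgePatch T E, F.sgn K = s := by
  have hα : F.α m = 0 := F.α_openSegment (by simp [hpq]) (by simp [hpq]) hm
  have hβ : F.β m = 0 := F.swap.α_openSegment (by simp [hpq]) (by simp [hpq]) hm
  obtain ⟨w, hw1, hw2⟩ := F.exists_linear_eq (if s.1 then 1 else -1) (if s.2 then 1 else -1)
  have hc : Filter.Tendsto (fun t : ℝ => m + t • w) (nhdsWithin 0 (Set.Ioi 0)) (nhds m) := by
    have : Continuous fun t : ℝ => m + t • w := by fun_prop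
    have := this.tendsto 0
    simp only [zero_smul, add_zero] at this
    exact this.mono_left nhdsWithin_le_nhds
  obtain ⟨t, ⟨K, hK, hmK, hyK⟩, ht⟩ :=
    ((hc.eventually (eventually_exists_tet_of_mem_dom F.mesh hmd)).and self_mem_nhdsWithin).exists
  have ht : 0 < t := ht
  obtain ⟨K₀, hK₀⟩ := edgePatch_nonempty F.mesh F.edge
  have hpos := baryCoord_pos_of_mem_openSegment hK₀ hpq hne hm
  have hmK₀ : m ∈ convexHull ℝ (K₀ : Set E3) :=
    convexHull_mono (by exact_mod_cast hK₀.2) (by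
      rw [hpq, Finset.coe_pair, convexHull_pair]; exact openSegment_subset_segment _ _ _ hm)
  have hKp := mem_edgePatch_of_mem hK₀ hK hmK₀ hmK hpos
  have hαt : F.α (m + t • w) = t * (if s.1 then 1 else -1) := by
    have := F.α.map_vadd m (t • w)
    simp only [vadd_eq_add, map_smul, hα, hw1, smul_eq_mul, add_zero] at this
    rw [add_comm, this]
  have hβt : F.β (m + t • w) = t * (if s.2 then 1 else -1) := by
    have := F.β.map_vadd m (t • w)
    simp only [vadd_eq_add, map_smul, hβ, hw2, smul_eq_mul, add_zero] at this
    rw [add_comm, this]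
  have hb := (mem_convexHull_tet_iff (T.indep hK.1) hK.2).1 hyK
  have h1 := hb _ (F.cv_mem K hKp)
  have h2 := hb _ (F.dv_mem K hKp)
  rw [baryCoord_cv hKp, hαt] at h1
  rw [baryCoord_dv hKp, hβt] at h2
  refine ⟨K, hKp, ?_⟩
  have key : ∀ (b : Bool) (x : ℝ), x ≠ 0 → 0 ≤ t * (if b then 1 else -1) / x →
      decide (0 < x) = b := by
    intro b x hx h
    cases b
    · simp only [Bool.false_eq_true, if_false, mul_neg, mul_one, neg_div] at h
      simp only [decide_eq_false_iff_not, not_lt]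
      by_contra hx'
      have := div_pos ht (not_le.1 hx')
      linarith
    · simp only [if_true, mul_one] at h
      simp only [decide_eq_true_eq]
      by_contra hx'
      have := div_neg_of_pos_of_neg ht (lt_of_le_of_ne (not_lt.1 hx') hx)
      linarith
  exact Prod.ext (key _ _ (F.α_cv K hKp) h1) (key _ _ (F.β_dv K hKp) h2)

/-- Four occupied closed wedges cover a neighbourhood of `m`. A point with `α = 0` or `β = 0` may be
assigned to either side. -/
lemma mem_dom_of_forall_sgn (F : EdgeFrame T E) {p q m : E3} (hpq : E = {p, q}) (hne : p ≠ q)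
    (hm : m ∈ openSegment ℝ p q) (h : ∀ s, ∃ K ∈ edgePatch T E, F.sgn K = s) : m ∈ dom T := by
  choose K hK hKs using h
  have e : ∀ᶠ x in nhds m, ∀ s, (x ∈ convexHull ℝ (K s : Set E3) ↔
      0 ≤ F.α x / F.α (F.cv (K s)) ∧ 0 ≤ F.β x / F.β (F.dv (K s))) :=
    Filter.eventually_all.2 fun s =>
      F.eventually_mem_iff (hK s) (baryCoord_pos_of_mem_openSegment (hK s) hpq hne hm)
  rw [dom, mem_interior_iff_mem_nhds]
  filter_upwards [e] with x hx
  refine Set.mem_iUnion₂.2 ⟨K (decide (0 < F.α x), decide (0 < F.β x)), (hK _).1, ?_⟩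
  rw [hx]
  have hs := hKs (decide (0 < F.α x), decide (0 < F.β x))
  simp only [sgn, Prod.mk.injEq, decide_eq_decide] at hs
  have key : ∀ a b : ℝ, (0 < a ↔ 0 < b) → 0 ≤ b / a := by
    intro a b hab
    by_cases hb : 0 < b
    · exact div_nonneg hb.le (hab.2 hb).le
    · exact div_nonneg_of_nonpos (not_lt.1 hb) (not_lt.1 (mt hab.1 hb))
  exact ⟨key _ _ hs.1, key _ _ hs.2⟩

/-- Points of a facet that lies in only one tetrahedron are not in the open domain. -/
lemma notMem_dom_of_unique (hK : K ∈ edgePatch T E)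
    (hu : ∀ K' ∈ edgePatch T E, F.cv K' = F.cv K → K' = K) {x : E3}
    (hx : ∀ e ∈ E, 0 < baryCoord K e x) (hxc : 0 < baryCoord K (F.cv K) x)
    (hxd : baryCoord K (F.dv K) x = 0) : x ∉ dom T := by
  intro hxdom
  have hxK : x ∈ convexHull ℝ (K : Set E3) := by
    rw [mem_convexHull_tet_iff (T.indep hK.1.1) hK.1.2]
    intro v hv
    rcases (mem_iff (F := F) hK).1 hv with rfl | rfl | hv
    exacts [hxc.le, hxd.ge, (hx v hv).le]
  have hint : x ∈ interior (convexHull ℝ (K : Set E3)) := by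
    rw [mem_interior_iff_mem_nhds]
    filter_upwards [eventually_exists_tet_of_mem_dom F.mesh hxdom] with y ⟨K', hK', hxK', hyK'⟩
    have hp := mem_edgePatch_of_mem hK hK' hxK hxK' hx
    have hc := mem_of_baryCoord_pos hK.1 hK'.1 hxK hxK' (F.cv_mem K hK) hxc
    have : F.cv K' = F.cv K := by
      rcases (mem_iff (F := F) hp).1 hc with h | h | h
      · exact h.symm
      · exact absurd (h ▸ F.α_dv K' hp) (F.α_cv K hK)
      · exact absurd h (cv_notMem hK)
    rwa [hu K' hp this] at hyK'
  rw [mem_interior_convexHull_tet_iff (T.indep hK.1.1) hK.1.2] at hint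
  exact (hint _ (F.dv_mem K hK)).ne' hxd

end EdgeFrame

/-- The edge lies in the closure of the domain, so a point off the frontier is in the open domain;
the open segment is dense in the edge. -/
lemma exists_openSegment_mem_dom (hT : IsTetMesh T) (hE : E ∈ innerEdges T) {p q : E3}
    (hpq : E = {p, q}) : ∃ m ∈ openSegment ℝ p q, m ∈ dom T := by
  obtain ⟨hE, hb⟩ := hE
  have hb : ¬ convexHull ℝ (E : Set E3) ⊆ frontier (dom T) := fun h => hb ⟨hE, h⟩
  obtain ⟨x, hx, hxf⟩ := Set.not_subset.1 hb
  obtain ⟨K, hK⟩ := edgePatch_nonempty hT hE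
  have hxc := convexHull_subset_closure_dom hK.1 (convexHull_mono (by exact_mod_cast hK.2) hx)
  have hxd : x ∈ dom T := by
    by_contra h
    exact hxf ((isOpen_dom T).frontier_eq ▸ ⟨hxc, h⟩)
  rw [hpq, Finset.coe_pair, convexHull_pair, ← closure_openSegment] at hx
  obtain ⟨m, h1, h2⟩ := mem_closure_iff.1 hx _ (isOpen_dom T) hxd
  exact ⟨m, h2, h1⟩

/-! ### Numberings of the patch of a critical edge -/

namespace EdgeFrame

variable {F : EdgeFrame T E}

lemma insert_cv_mem_triangles [DecidableEq E3] (hK : K ∈ edgePatch T E) :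
    insert (F.cv K) E ∈ triangles T :=
  insert_mem_triangles F.edge hK (F.cv_mem K hK) (cv_notMem hK)

lemma convexHull_insert_cv_subset [DecidableEq E3] (hK : K ∈ edgePatch T E) :
    convexHull ℝ ((insert (F.cv K) E : Finset E3) : Set E3) ⊆ (F.P : Set E3) := by
  refine convexHull_min ?_ F.P.convex
  rw [Finset.coe_insert]
  exact Set.insert_subset (F.cv_mem_P K hK) F.edge_subset_P

lemma insert_cv_subset [DecidableEq E3] (hK : K ∈ edgePatch T E) : insert (F.cv K) E ⊆ K :=
  Finset.insert_subset (F.cv_mem K hK) hK.2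

lemma shareFacet_of_sgn_fst_eq (hK : K ∈ edgePatch T E) (hK' : K' ∈ edgePatch T E)
    (h : (F.sgn K).1 = (F.sgn K').1) : ShareFacet T K K' := by
  classical
  exact ⟨insert (F.cv K) E, insert_cv_mem_triangles hK, insert_cv_subset hK,
    cv_eq_of_sgn_eq hK hK' h ▸ insert_cv_subset hK'⟩

lemma shareFacet_of_sgn_snd_eq (hK : K ∈ edgePatch T E) (hK' : K' ∈ edgePatch T E)
    (h : (F.sgn K).2 = (F.sgn K').2) : ShareFacet T K K' :=
  F.swap.shareFacet_of_sgn_fst_eq hK hK' h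

/-- Otherwise all common vertices belong to `E`, too few for a triangle. -/
lemma cv_eq_or_dv_eq_of_shareFacet (hK : K ∈ edgePatch T E) (hK' : K' ∈ edgePatch T E)
    (h : ShareFacet T K K') : F.cv K = F.cv K' ∨ F.dv K = F.dv K' := by
  by_contra! hcon
  obtain ⟨G, hG, h1, h2⟩ := h
  have hGE : G ⊆ E := by
    intro x hx
    rcases (mem_iff (F := F) hK).1 (h1 hx) with rfl | rfl | h
    · rcases (mem_iff (F := F) hK').1 (h2 hx) with h | h | h
      · exact absurd h hcon.1
      · exact absurd (h ▸ F.α_dv K' hK') (F.α_cv K hK)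
      · exact h
    · rcases (mem_iff (F := F) hK').1 (h2 hx) with h | h | h
      · exact absurd (h ▸ F.β_cv K' hK') (F.β_dv K hK)
      · exact absurd h hcon.2
      · exact h
    · exact h
  have := Finset.card_le_card hGE
  rw [hG.2, F.edge.2] at this
  omega

/-- The sign of a wedge: opposite wedges have equal signs. -/
noncomputable def wedgeSign (s : Bool × Bool) : ℝ := if s.1 = s.2 then 1 else -1

lemma wedgeSign_ne_zero (s : Bool × Bool) : wedgeSign s ≠ 0 := by
  unfold wedgeSign
  split_ifs <;> norm_num

/-- Distinct tetrahedra with a common facet differ in exactly one of the two signs. -/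
lemma wedgeSign_eq_neg_of_shareFacet (hK : K ∈ edgePatch T E) (hK' : K' ∈ edgePatch T E)
    (hne : K ≠ K') (h : ShareFacet T K K') :
    wedgeSign (F.sgn K') = - wedgeSign (F.sgn K) := by
  have h1 : F.sgn K ≠ F.sgn K' := fun h => hne (eq_of_sgn_eq hK hK' h)
  have h2 : (F.sgn K).1 = (F.sgn K').1 ∨ (F.sgn K).2 = (F.sgn K').2 :=
    (cv_eq_or_dv_eq_of_shareFacet hK hK' h).imp (fun h => by rw [sgn, sgn, h]) fun h => by rw [sgn, sgn, h]
  generalize F.sgn K = s at *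
  generalize F.sgn K' = s' at *
  obtain ⟨a, b⟩ := s
  obtain ⟨a', b'⟩ := s'
  cases a <;> cases b <;> cases a' <;> cases b' <;> simp_all [wedgeSign]

lemma mem_edgePatch_numbering {n : ℕ} {K : Fin n → Finset E3} (hK : IsPatchNumbering T E K)
    (i : Fin n) : K i ∈ edgePatch T E := hK.range_eq ▸ Set.mem_range_self i

lemma sgn_injective_numbering (F : EdgeFrame T E) {n : ℕ} {K : Fin n → Finset E3}
    (hK : IsPatchNumbering T E K) : Function.Injective fun i => F.sgn (K i) := fun i j h =>
  hK.injective (eq_of_sgn_eq (mem_edgePatch_numbering hK i) (mem_edgePatch_numbering hK j) h)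

lemma one_le_of_numbering (F : EdgeFrame T E) {n : ℕ} {K : Fin n → Finset E3}
    (hK : IsPatchNumbering T E K) : 1 ≤ n := by
  obtain ⟨K₀, h⟩ := edgePatch_nonempty F.mesh F.edge
  rw [← hK.range_eq] at h
  obtain ⟨i, -⟩ := h
  exact i.pos

lemma wedgeSign_numbering (F : EdgeFrame T E) {n : ℕ} {K : Fin (n + 1) → Finset E3}
    (hK : IsPatchNumbering T E K) (hs : ∀ i j : Fin (n + 1), (j : ℕ) = (i : ℕ) + 1 →
      ShareFacet T (K i) (K j)) (i : Fin (n + 1)) :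
    wedgeSign (F.sgn (K i)) = (-1) ^ (i : ℕ) * wedgeSign (F.sgn (K 0)) := by
  obtain ⟨i, hi⟩ := i
  induction i with
  | zero => simp
  | succ i ih =>
    have hi' : i < n + 1 := by omega
    rw [wedgeSign_eq_neg_of_shareFacet (mem_edgePatch_numbering hK ⟨i, hi'⟩)
      (mem_edgePatch_numbering hK ⟨i + 1, hi⟩)
      (fun h => by simpa using hK.injective h) (hs _ _ rfl), ih hi']
    simp [pow_succ]

lemma exists_cyclicNumbering (F : EdgeFrame T E) (h : ∀ s, ∃ K ∈ edgePatch T E, F.sgn K = s) :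
    ∃ K : Fin 4 → Finset E3, IsPatchNumbering T E K ∧ IsCyclicNumbering T K := by
  classical
  choose K hK hKs using h
  -- The quadrants in cyclic order: the steps change the sign of `α` and of `β` in turn, so the
  -- common facets lie alternately in `Q` and in `P`.
  set s : Fin 4 → Bool × Bool := ![(true, true), (false, true), (false, false), (true, false)] with hs
  have hsurj : Function.Surjective s := by decide
  have hinj : Function.Injective s := by decide
  have c12 : F.cv (K (s 1)) = F.cv (K (s 2)) := cv_eq_of_sgn_eq (hK _) (hK _) (by simp [hKs, hs])
  have c30 : F.cv (K (s 3)) = F.cv (K (s 0)) := cv_eq_of_sgn_eq (hK _) (hK _) (by simp [hKs, hs])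
  have d01 : F.dv (K (s 0)) = F.dv (K (s 1)) := dv_eq_of_sgn_eq (hK _) (hK _) (by simp [hKs, hs])
  have d23 : F.dv (K (s 2)) = F.dv (K (s 3)) := dv_eq_of_sgn_eq (hK _) (hK _) (by simp [hKs, hs])
  refine ⟨fun i => K (s i), ⟨?_, ?_, ?_⟩, ?_⟩
  · intro i j hij
    have := congrArg F.sgn hij
    simp only [hKs] at this
    exact hinj this
  · ext L
    constructor
    · rintro ⟨i, rfl⟩
      exact hK _
    · intro hL
      obtain ⟨i, hi⟩ := hsurj (F.sgn L)
      exact ⟨i, eq_of_sgn_eq (F := F) (hK _) hL (by rw [hKs, hi])⟩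
  · intro _ i j hij
    have : (F.sgn (K (s i))).1 = (F.sgn (K (s j))).1 ∨
        (F.sgn (K (s i))).2 = (F.sgn (K (s j))).2 := by
      simp only [hKs]
      revert i j
      decide
    exact this.elim (shareFacet_of_sgn_fst_eq (hK _) (hK _))
      (shareFacet_of_sgn_snd_eq (hK _) (hK _))
  · have hc := fun i => insert_cv_mem_triangles (F := F) (hK (s i))
    have hd := fun i => insert_cv_mem_triangles (F := F.swap) (hK (s i))
    have hc' := fun i => insert_cv_subset (F := F) (hK (s i))
    have hd' := fun i => insert_cv_subset (F := F.swap) (hK (s i))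
    refine ⟨![insert (F.dv (K (s 0))) E, insert (F.cv (K (s 1))) E, insert (F.dv (K (s 2))) E,
      insert (F.cv (K (s 3))) E], F.Q, F.P, ?_, F.isPlane_Q, F.isPlane_P, F.P_ne_Q.symm,
      convexHull_insert_cv_subset (F := F.swap) (hK _),
      convexHull_insert_cv_subset (F := F.swap) (hK _),
      convexHull_insert_cv_subset (hK _), convexHull_insert_cv_subset (hK _)⟩
    rw [Fin.forall_fin_succ, Fin.forall_fin_succ, Fin.forall_fin_succ, Fin.forall_fin_succ]
    refine ⟨⟨hd 0, hd' 0, ?_⟩, ⟨hc 1, hc' 1, ?_⟩, ⟨hd 2, hd' 2, ?_⟩, ⟨hc 3, hc' 3, ?_⟩, fun i => i.elim0⟩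
    · change insert (F.dv (K (s 0))) E ⊆ K (s 1)
      rw [d01]; exact hd' 1
    · change insert (F.cv (K (s 1))) E ⊆ K (s 2)
      rw [c12]; exact hc' 2
    · change insert (F.dv (K (s 2))) E ⊆ K (s 3)
      rw [d23]; exact hd' 3
    · change insert (F.cv (K (s 3))) E ⊆ K (s 0)
      rw [c30]; exact hc' 0

lemma exists_numbering_of_missing (F : EdgeFrame T E) {s : Bool × Bool}
    (hs : ∀ K ∈ edgePatch T E, F.sgn K ≠ s) :
    ∃ n : ℕ, 1 ≤ n ∧ n ≤ 3 ∧ ∃ K : Fin n → Finset E3, IsPatchNumbering T E K := by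
  classical
  have hfin : (edgePatch T E).Finite := F.mesh.finite_tets.subset fun K hK => hK.1
  have hcard : (edgePatch T E).ncard ≤ 3 := by
    have h1 : (F.sgn '' edgePatch T E).ncard = (edgePatch T E).ncard :=
      Set.InjOn.ncard_image fun K hK K' hK' h => eq_of_sgn_eq hK hK' h
    have h2 : F.sgn '' edgePatch T E ⊆ ((Finset.univ.erase s : Finset (Bool × Bool)) : Set _) := by
      rintro _ ⟨K, hK, rfl⟩
      simpa using hs K hK
    have h3 := Set.ncard_le_ncard h2 (Finset.finite_toSet _)
    rw [Set.ncard_coe_finset, Finset.card_erase_of_mem (Finset.mem_univ s)] at h3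
    simp at h3
    omega
  have hpos : 1 ≤ (edgePatch T E).ncard :=
    (Set.ncard_pos hfin).2 (edgePatch_nonempty F.mesh F.edge)
  by_cases h3 : (edgePatch T E).ncard = 3
  · have hall : ∀ t, t ≠ s → ∃ K ∈ edgePatch T E, F.sgn K = t := by
      intro t ht
      by_contra! hcon
      have h1 : (F.sgn '' edgePatch T E).ncard = (edgePatch T E).ncard :=
        Set.InjOn.ncard_image fun K hK K' hK' h => eq_of_sgn_eq hK hK' h
      have h2 : F.sgn '' edgePatch T E ⊆
          (((Finset.univ.erase s).erase t : Finset (Bool × Bool)) : Set _) := by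
        rintro _ ⟨K, hK, rfl⟩
        simpa using And.intro (hs K hK) (hcon K hK)
      have h4 := Set.ncard_le_ncard h2 (Finset.finite_toSet _)
      rw [Set.ncard_coe_finset, Finset.card_erase_of_mem (by simpa using ht),
        Finset.card_erase_of_mem (Finset.mem_univ s)] at h4
      simp at h4
      omega
    choose! K hK hKs using hall
    -- The wedge opposite to the missing one comes in the middle; it is adjacent to both others.
    set t : Fin 3 → Bool × Bool := ![(!s.1, s.2), (!s.1, !s.2), (s.1, !s.2)] with ht
    have hts : ∀ i, t i ≠ s := by
      rw [ht]; clear * -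
      revert s; decide
    have hinj : Function.Injective t := by
      rw [ht]; clear * -
      revert s; decide
    have hsurj : ∀ r, r ≠ s → ∃ i, t i = r := by
      rw [ht]; clear * -
      revert s; decide
    refine ⟨3, by norm_num, le_rfl, fun i => K (t i), ?_, ?_, ?_⟩
    · intro i j hij
      have := congrArg F.sgn hij
      simp only [hKs _ (hts _)] at this
      exact hinj this
    · ext L
      constructor
      · rintro ⟨i, rfl⟩
        exact hK _ (hts i)
      · intro hL
        obtain ⟨i, hi⟩ := hsurj (F.sgn L) (hs L hL)
        exact ⟨i, eq_of_sgn_eq (F := F) (hK _ (hts i)) hL (by rw [hKs _ (hts i), hi])⟩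
    · intro _ i j hij
      have : (F.sgn (K (t i))).1 = (F.sgn (K (t j))).1 ∨
          (F.sgn (K (t i))).2 = (F.sgn (K (t j))).2 := by
        simp only [hKs _ (hts _)]
        rw [ht]
        clear * - hij
        revert i j s
        decide
      exact this.elim (shareFacet_of_sgn_fst_eq (hK _ (hts i)) (hK _ (hts j)))
        (shareFacet_of_sgn_snd_eq (hK _ (hts i)) (hK _ (hts j)))
  -- One or two tetrahedra: every enumeration is admissible.
  · have := hfin.to_subtype
    have e : (edgePatch T E) ≃ Fin (edgePatch T E).ncard :=
      (Finite.equivFin _).trans (finCongr (Nat.card_coe_set_eq _))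
    refine ⟨_, hpos, hcard, fun i => (e.symm i : Finset E3), ?_, ?_, fun h => by omega⟩
    · exact Subtype.val_injective.comp e.symm.injective
    · rw [show (fun i => (e.symm i : Finset E3)) = Subtype.val ∘ e.symm from rfl,
        e.symm.surjective.range_comp, Subtype.range_coe]

/-! ### Alternating sums over the edge patch -/

/-- The linear functional `L` vanishes in the directions of the facet spanned by `E` and `c`. -/
def KillsFacet (E : Finset E3) (c : E3) (L : E3 →ₗ[ℝ] ℝ) : Prop :=
  (∀ e ∈ E, ∀ e' ∈ E, L (e - e') = 0) ∧ ∀ e ∈ E, L (c - e) = 0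

/-- The functionals `G K` agree along the common facets on the plane `P`, and vanish along those
facets on `P` that belong to one tetrahedron only. -/
def Compatible (F : EdgeFrame T E) (G : Finset E3 → E3 →ₗ[ℝ] ℝ) : Prop :=
  (∀ K ∈ edgePatch T E, ∀ K' ∈ edgePatch T E, K ≠ K' → F.cv K = F.cv K' →
    KillsFacet E (F.cv K) (G K - G K')) ∧
  ∀ K ∈ edgePatch T E, (∀ K' ∈ edgePatch T E, F.cv K' = F.cv K → K' = K) →
    KillsFacet E (F.cv K) (G K)

/-- Being constant along `E`, `L` is a combination of `dα` and `dβ`; in the direction of `cv K` only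
the `dα` part is seen, so its coefficient is zero. -/
lemma KillsFacet.exists_eq_smul (hK : K ∈ edgePatch T E) {L : E3 →ₗ[ℝ] ℝ}
    (h : KillsFacet E (F.cv K) L) : ∃ B : ℝ, L = B • F.β.linear := by
  obtain ⟨A, B, hL⟩ := F.exists_eq_add_of_edge L h.1
  obtain ⟨e, he⟩ := T.nonempty_of_mem_faces F.edge.1
  have h1 := h.2 e he
  have hα := F.α.linearMap_vsub (F.cv K) e
  have hβ := F.β.linearMap_vsub (F.cv K) e
  simp only [vsub_eq_sub, F.α_edge e he, F.β_edge e he, F.β_cv K hK, sub_zero] at hα hβ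
  rw [hL] at h1
  simp only [LinearMap.add_apply, LinearMap.smul_apply, hα, hβ, smul_eq_mul, mul_zero,
    add_zero, mul_eq_zero, F.α_cv K hK, or_false] at h1
  exact ⟨B, by simp [hL, h1]⟩

/-- Here `g` extends `G` by zero to empty wedges, so a shared facet, a facet with a single
tetrahedron and an absent facet all give the same conclusion. -/
lemma Compatible.exists_sub_eq_smul {G : Finset E3 → E3 →ₗ[ℝ] ℝ} (hG : F.Compatible G)
    {g : Bool × Bool → E3 →ₗ[ℝ] ℝ} (hg : ∀ K ∈ edgePatch T E, g (F.sgn K) = G K)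
    (hg0 : ∀ s, (∀ K ∈ edgePatch T E, F.sgn K ≠ s) → g s = 0) (σ : Bool) :
    ∃ B : ℝ, g (σ, true) - g (σ, false) = B • F.β.linear := by
  have single : ∀ τ, ∀ K ∈ edgePatch T E, F.sgn K = (σ, τ) →
      (∀ K ∈ edgePatch T E, F.sgn K ≠ (σ, !τ)) → ∃ B : ℝ, g (σ, τ) = B • F.β.linear := by
    intro τ K hK hs hn
    rw [← hs, hg K hK]
    refine (hG.2 K hK fun K' hK' hc => eq_of_sgn_eq (F := F) hK' hK ?_).exists_eq_smul hK
    have h1 : (F.sgn K').1 = σ := by rw [sgn_fst_eq_of_cv_eq hc, hs]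
    have h2 : (F.sgn K').2 = τ := by
      have := hn K' hK'
      rw [Ne, Prod.ext_iff, not_and] at this
      simpa using this h1
    rw [hs, ← h1, ← h2]
  by_cases ht : ∃ K ∈ edgePatch T E, F.sgn K = (σ, true) <;>
    by_cases hf : ∃ K ∈ edgePatch T E, F.sgn K = (σ, false)
  · obtain ⟨K, hK, hs⟩ := ht
    obtain ⟨K', hK', hs'⟩ := hf
    rw [← hs, ← hs', hg K hK, hg K' hK']
    refine (hG.1 K hK K' hK' ?_ (cv_eq_of_sgn_eq hK hK' (by rw [hs, hs']))).exists_eq_smul hK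
    rintro rfl
    simp [hs] at hs'
  · push Not at hf
    obtain ⟨K, hK, hs⟩ := ht
    rw [hg0 _ hf, sub_zero]
    exact single true K hK hs hf
  · push Not at ht
    obtain ⟨K, hK, hs⟩ := hf
    obtain ⟨B, hB⟩ := single false K hK hs ht
    exact ⟨-B, by rw [hg0 _ ht, hB]; module⟩
  · push Not at ht hf
    exact ⟨0, by simp [hg0 _ ht, hg0 _ hf]⟩

lemma eq_zero_of_smul_eq_smul (F : EdgeFrame T E) {A B : ℝ} {L : E3 →ₗ[ℝ] ℝ}
    (hA : L = A • F.α.linear) (hB : L = B • F.β.linear) : L = 0 := by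
  obtain ⟨w, h1, h2⟩ := F.exists_linear_eq 1 0
  have h := congrArg (fun f => f w) (hA.symm.trans hB)
  simp only [LinearMap.smul_apply, h1, h2, smul_eq_mul, mul_one, mul_zero] at h
  rw [hA, h, zero_smul]

/-- Grouping the four wedges across the half-planes of `P` gives a multiple of `dβ`, grouping across
those of `Q` a multiple of `dα`. The two are linearly independent. -/
lemma Compatible.sum_eq_zero {G : Finset E3 → E3 →ₗ[ℝ] ℝ} (hG : F.Compatible G)
    (hG' : F.swap.Compatible G) {n : ℕ} {K : Fin n → Finset E3} (hK : IsPatchNumbering T E K) :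
    ∑ i, wedgeSign (F.sgn (K i)) • G (K i) = 0 := by
  classical
  set g : Bool × Bool → E3 →ₗ[ℝ] ℝ := fun s => ∑ i, if F.sgn (K i) = s then G (K i) else 0 with hgdef
  have hg : ∀ L ∈ edgePatch T E, g (F.sgn L) = G L := by
    intro L hL
    rw [← hK.range_eq] at hL
    obtain ⟨i, rfl⟩ := hL
    have : ∀ j, F.sgn (K j) = F.sgn (K i) ↔ j = i := fun j => (F.sgn_injective_numbering hK).eq_iff
    simp [hgdef, this]
  have hg0 : ∀ s, (∀ L ∈ edgePatch T E, F.sgn L ≠ s) → g s = 0 := by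
    intro s hs
    exact Finset.sum_eq_zero fun i _ => if_neg (hs _ (mem_edgePatch_numbering hK i))
  have hS : ∑ i, wedgeSign (F.sgn (K i)) • G (K i) = ∑ s, wedgeSign s • g s := by
    simp_rw [hgdef, Finset.smul_sum]
    rw [Finset.sum_comm]
    refine Finset.sum_congr rfl fun i _ => ?_
    rw [Finset.sum_eq_single (F.sgn (K i))]
    · simp
    · intro s _ hs
      simp [hs.symm]
    · simp
  rw [hS]
  have hS' : ∑ s, wedgeSign s • g s =
      (g (true, true) - g (true, false)) - (g (false, true) - g (false, false)) := by
    simp only [Fintype.sum_prod_type, Fintype.sum_bool, wedgeSign]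
    simp
    module
  obtain ⟨B₁, h1⟩ := hG.exists_sub_eq_smul hg hg0 true
  obtain ⟨B₀, h0⟩ := hG.exists_sub_eq_smul hg hg0 false
  have hgs : ∀ L ∈ edgePatch T E, g (F.swap.sgn L).swap = G L := hg
  have hgs0 : ∀ s, (∀ L ∈ edgePatch T E, F.swap.sgn L ≠ s) → g s.swap = 0 := fun s hs =>
    hg0 _ fun L hL h => hs L hL (by rw [← Prod.swap_swap s, ← h]; rfl)
  obtain ⟨A₁, h1'⟩ := hG'.exists_sub_eq_smul (g := fun s => g s.swap) hgs hgs0 true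
  obtain ⟨A₀, h0'⟩ := hG'.exists_sub_eq_smul (g := fun s => g s.swap) hgs hgs0 false
  simp only [Prod.swap_prod_mk] at h1' h0'
  refine F.eq_zero_of_smul_eq_smul (A := A₁ - A₀) (B := B₁ - B₀) ?_ ?_
  · rw [hS']
    have e1 : A₁ • F.α.linear = g (true, true) - g (false, true) := h1'.symm
    have e0 : A₀ • F.α.linear = g (true, false) - g (false, false) := h0'.symm
    have e : (A₁ - A₀) • F.α.linear = A₁ • F.α.linear - A₀ • F.α.linear := by module
    rw [e, e1, e0]; abel
  · rw [hS', h1, h0]; module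

/-- If no other tetrahedron of the patch shares a facet at `E`, then `G K` vanishes along both
facets and is a multiple of `dβ` and of `dα`. -/
lemma Compatible.eq_zero {G : Finset E3 → E3 →ₗ[ℝ] ℝ} (hG : F.Compatible G)
    (hG' : F.swap.Compatible G) (hK : K ∈ edgePatch T E)
    (hc : ∀ K' ∈ edgePatch T E, F.cv K' = F.cv K → K' = K)
    (hd : ∀ K' ∈ edgePatch T E, F.dv K' = F.dv K → K' = K) : G K = 0 := by
  obtain ⟨B, hB⟩ := (hG.2 K hK hc).exists_eq_smul hK
  obtain ⟨A, hA⟩ := KillsFacet.exists_eq_smul (F := F.swap) hK (hG'.2 K hK hd)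
  exact F.eq_zero_of_smul_eq_smul hA hB

/-- The alternating sum over any admissible numbering of the patch vanishes. -/
lemma Compatible.alternating_sum_eq_zero {G : Finset E3 → E3 →ₗ[ℝ] ℝ} (hG : F.Compatible G)
    (hG' : F.swap.Compatible G) {n : ℕ} {K : Fin n → Finset E3} (hK : IsPatchNumbering T E K) :
    ∑ i : Fin n, (-1 : ℝ) ^ (i : ℕ) • G (K i) = 0 := by
  obtain ⟨n, rfl⟩ : ∃ m, n = m + 1 := ⟨n - 1, by have := F.one_le_of_numbering hK; omega⟩
  by_cases hs : ∀ i j : Fin (n + 1), (j : ℕ) = (i : ℕ) + 1 → ShareFacet T (K i) (K j)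
  · have h0 := hG.sum_eq_zero hG' hK
    have h1 : ∀ i, wedgeSign (F.sgn (K i)) • G (K i) =
        wedgeSign (F.sgn (K 0)) • ((-1 : ℝ) ^ (i : ℕ) • G (K i)) := by
      intro i
      rw [F.wedgeSign_numbering hK hs i, mul_comm, mul_smul]
    rw [Finset.sum_congr rfl fun i _ => h1 i, ← Finset.smul_sum, smul_eq_zero] at h0
    refine h0.resolve_left ?_
    exact wedgeSign_ne_zero _
  -- The remaining case is two tetrahedra in opposite wedges. There the signs `(-1)^i` do not match
  -- the wedge signs, but each term is zero by itself.
  · push Not at hs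
    obtain ⟨i, j, hij, hns⟩ := hs
    have hn : n = 1 := by
      by_contra hn'
      exact hns (hK.share (by omega) i j hij)
    subst hn
    have hi : i = 0 := Fin.ext (show (i : ℕ) = 0 by omega)
    have hj : j = 1 := Fin.ext (show (j : ℕ) = 1 by omega)
    subst hi hj
    have hp := fun i => mem_edgePatch_numbering hK i
    have hcne : F.cv (K 0) ≠ F.cv (K 1) := fun h =>
      hns (shareFacet_of_sgn_fst_eq (F := F) (hp 0) (hp 1) (by simp [sgn, h]))
    have hdne : F.dv (K 0) ≠ F.dv (K 1) := fun h =>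
      hns (shareFacet_of_sgn_snd_eq (F := F) (hp 0) (hp 1) (by simp [sgn, h]))
    have hall : ∀ L ∈ edgePatch T E, L = K 0 ∨ L = K 1 := by
      intro L hL
      rw [← hK.range_eq] at hL
      obtain ⟨i, rfl⟩ := hL
      fin_cases i <;> simp
    have z0 : G (K 0) = 0 := by
      refine hG.eq_zero hG' (hp 0) ?_ ?_ <;> intro L hL h <;> rcases hall L hL with rfl | rfl
      exacts [rfl, absurd h.symm hcne, rfl, absurd h.symm hdne]
    have z1 : G (K 1) = 0 := by
      refine hG.eq_zero hG' (hp 1) ?_ ?_ <;> intro L hL h <;> rcases hall L hL with rfl | rfl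
      exacts [absurd h hcne, rfl, absurd h hdne, rfl]
    simp [Fin.sum_univ_two, z0, z1]

end EdgeFrame

/-! ### Gradients of finite element functions at the end points of a critical edge -/

/-- Continuity gives `f p = 0`, and the one-sided derivative along the ray is unique. -/
lemma fderiv_apply_eq_zero_of_eventually {f : E3 → ℝ} {p w : E3} (hf : DifferentiableAt ℝ f p)
    (h : ∀ᶠ t in nhdsWithin (0 : ℝ) (Set.Ioi 0), f (p + t • w) = 0) : fderiv ℝ f p w = 0 := by
  have hl : HasDerivAt (fun t : ℝ => p + t • w) w 0 := by
    simpa using ((hasDerivAt_id (0 : ℝ)).smul_const w).const_add p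
  have hf' : HasFDerivAt f (fderiv ℝ f p) (p + (0 : ℝ) • w) := by simpa using hf.hasFDerivAt
  have hd : HasDerivAt (fun t : ℝ => f (p + t • w)) (fderiv ℝ f p w) 0 :=
    hf'.comp_hasDerivAt 0 hl
  have h0 : f (p + (0 : ℝ) • w) = 0 := by
    have h1 := hd.continuousAt.tendsto.mono_left (nhdsWithin_le_nhds (s := Set.Ioi (0 : ℝ)))
    exact tendsto_nhds_unique h1 ((Filter.tendsto_congr' h).2 tendsto_const_nhds)
  have h1 : HasDerivWithinAt (fun t : ℝ => f (p + t • w)) 0 (Set.Ioi 0) 0 :=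
    (hasDerivWithinAt_const (0 : ℝ) (Set.Ioi (0 : ℝ)) (0 : ℝ)).congr_of_eventuallyEq h h0
  exact (uniqueDiffWithinAt_Ioi (0 : ℝ)).eq_deriv _ hd.hasDerivWithinAt h1

lemma EdgeFrame.killsFacet_fderiv {p q c : E3} (hpq : E = {p, q}) {f : E3 → ℝ}
    (hf : DifferentiableAt ℝ f p)
    (h : ∀ a b r : ℝ, 0 < a → 0 < b → 0 < r → a + b + r = 1 → f (a • p + b • q + r • c) = 0) :
    EdgeFrame.KillsFacet E c (fderiv ℝ f p : E3 →ₗ[ℝ] ℝ) := by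
  -- Vanishing is known only on the open triangle, so the derivative is tested along rays from `p`
  -- into it; two slopes `j` suffice to span the plane.
  have key : ∀ j : ℝ, 0 < j → fderiv ℝ f p ((c - p) + j • (q - p)) = 0 := by
    intro j hj
    refine fderiv_apply_eq_zero_of_eventually hf ?_
    have : Set.Ioo (0 : ℝ) (1 / (1 + j)) ∈ nhdsWithin (0 : ℝ) (Set.Ioi 0) :=
      Ioo_mem_nhdsGT (by positivity)
    filter_upwards [this] with t ht
    have h1 : t * (1 + j) < 1 := by
      have := ht.2
      rwa [lt_div_iff₀ (by positivity)] at this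
    have := h (1 - t * (1 + j)) (t * j) t (by linarith) (mul_pos ht.1 hj) ht.1 (by ring)
    rw [← this]
    congr 1
    module
  have k1 := key 1 one_pos
  have k2 := key 2 two_pos
  simp only [map_add, map_smul, smul_eq_mul] at k1 k2
  have hq : fderiv ℝ f p (q - p) = 0 := by linarith
  have hc : fderiv ℝ f p (c - p) = 0 := by linarith
  have hq' : fderiv ℝ f p (p - q) = 0 := by rw [← neg_sub, map_neg, hq, neg_zero]
  have hc' : fderiv ℝ f p (c - q) = 0 := by
    rw [← sub_sub_sub_cancel_right c q p, map_sub, hc, hq, sub_zero]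
  subst hpq
  constructor
  · intro e he e' he'
    simp only [Finset.mem_insert, Finset.mem_singleton] at he he'
    rcases he with rfl | rfl <;> rcases he' with rfl | rfl <;> simp_all
  · intro e he
    simp only [Finset.mem_insert, Finset.mem_singleton] at he
    rcases he with rfl | rfl <;> simp_all

lemma affineMap_combo₃ (f : E3 →ᵃ[ℝ] ℝ) {a b r : ℝ} (h : a + b + r = 1) (x y z : E3) :
    f (a • x + b • y + r • z) = a * f x + b * f y + r * f z := by
  have e : ∀ w, f w = f.linear w + f 0 := fun w => by simpa using congrFun f.decomp w
  rw [e, e x, e y, e z]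
  simp only [map_add, map_smul, smul_eq_mul]
  linear_combination -(f 0) * h

lemma combo₃_mem_convexHull {x y z : E3} (hx : x ∈ K) (hy : y ∈ K) (hz : z ∈ K) {a b r : ℝ}
    (ha : 0 < a) (hb : 0 < b) (hr : 0 < r) (h : a + b + r = 1) :
    a • x + b • y + r • z ∈ convexHull ℝ (K : Set E3) := by
  have hc := convex_convexHull ℝ (K : Set E3)
  have hs : ∀ v ∈ K, v ∈ convexHull ℝ (K : Set E3) := fun v hv => subset_convexHull ℝ _ hv
  have h1 := hc (hs x hx) (hs y hy) (a := a / (a + b)) (b := b / (a + b)) (by positivity)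
    (by positivity) (by field_simp)
  have h2 := hc h1 (hs z hz) (a := a + b) (b := r) (by positivity) hr.le h
  convert h2 using 2
  rw [smul_add, smul_smul, smul_smul]
  congr 2 <;> field_simp

lemma differentiable_mvPolynomial_eval (q : MvPolynomial (Fin 3) ℝ) :
    Differentiable ℝ fun y : E3 => MvPolynomial.eval (fun i => y i) q := fun x =>
  (hasFDerivAt_mvPolynomial_eval q x).differentiableAt

/-- The gradient at `p` of a polynomial. -/
noncomputable def polyGrad (p : E3) (q : MvPolynomial (Fin 3) ℝ) : E3 →ₗ[ℝ] ℝ :=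
  (fderiv ℝ (fun y : E3 => MvPolynomial.eval (fun i => y i) q) p : E3 →ₗ[ℝ] ℝ)

lemma polyGrad_single (p : E3) (q : MvPolynomial (Fin 3) ℝ) (j : Fin 3) :
    polyGrad p q (EuclideanSpace.single j 1) =
      MvPolynomial.eval (fun i => p i) (MvPolynomial.pderiv j q) := by
  simp [polyGrad, (hasFDerivAt_mvPolynomial_eval q p).fderiv]

/-- On a common facet both polynomials equal `u`. The relatively open facet of a single tetrahedron
lies outside the open domain, where `u` is zero. -/
lemma EdgeFrame.compatible_polyGrad (F : EdgeFrame T E) {p q : E3} (hne : p ≠ q) (hpq : E = {p, q})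
    {k : ℕ} {u : E3 → ℝ} (hu : u ∈ scalarSpace T k) {g : Finset E3 → MvPolynomial (Fin 3) ℝ}
    (hg : ∀ K ∈ tets T, ∀ x ∈ convexHull ℝ (K : Set E3),
      u x = MvPolynomial.eval (fun i => x i) (g K)) :
    F.Compatible fun K => polyGrad p (g K) := by
  have hp : p ∈ E := by simp [hpq]
  have hq : q ∈ E := by simp [hpq]
  have hmem : ∀ K ∈ edgePatch T E, ∀ a b r : ℝ, 0 < a → 0 < b → 0 < r → a + b + r = 1 →
      a • p + b • q + r • F.cv K ∈ convexHull ℝ (K : Set E3) := fun K hK a b r ha hb hr h =>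
    combo₃_mem_convexHull (hK.2 hp) (hK.2 hq) (F.cv_mem K hK) ha hb hr h
  constructor
  · intro K hK K' hK' _ hc
    have : polyGrad p (g K) - polyGrad p (g K') = (fderiv ℝ (fun y : E3 =>
        MvPolynomial.eval (fun i => y i) (g K) - MvPolynomial.eval (fun i => y i) (g K')) p :
          E3 →ₗ[ℝ] ℝ) := by
      rw [fderiv_fun_sub (differentiable_mvPolynomial_eval _ p)
        (differentiable_mvPolynomial_eval _ p)]
      rfl
    rw [this]
    refine killsFacet_fderiv hpq ((differentiable_mvPolynomial_eval _ p).sub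
      (differentiable_mvPolynomial_eval _ p)) fun a b r ha hb hr h => ?_
    rw [← hg K hK.1 _ (hmem K hK a b r ha hb hr h), hc,
      ← hg K' hK'.1 _ (hmem K' hK' a b r ha hb hr h), sub_self]
  · intro K hK hu'
    refine killsFacet_fderiv hpq (differentiable_mvPolynomial_eval _ p) fun a b r ha hb hr h => ?_
    rw [← hg K hK.1 _ (hmem K hK a b r ha hb hr h)]
    refine hu.2.2 _ (notMem_dom_of_unique (F := F) hK hu' ?_ ?_ ?_)
    · intro e he
      have hcE := cv_notMem (F := F) hK
      obtain ⟨h1, h0⟩ := baryCoord_spec (T.indep hK.1.1) hK.1.2 (hK.2 he)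
      rw [affineMap_combo₃ _ h]
      rw [h0 _ (F.cv_mem K hK) (by rintro rfl; exact hcE he)]
      rw [hpq] at he
      rcases Finset.mem_insert.1 he with rfl | he
      · rw [h1, h0 q (hK.2 hq) hne.symm]; simpa using ha
      · obtain rfl := Finset.mem_singleton.1 he
        rw [h1, h0 p (hK.2 hp) hne]; simpa using hb
    · rw [affineMap_combo₃ _ h, baryCoord_cv hK, baryCoord_cv hK, baryCoord_cv hK,
        F.α_edge p hp, F.α_edge q hq, div_self (F.α_cv K hK)]
      simpa using hr
    · rw [affineMap_combo₃ _ h, baryCoord_dv hK, baryCoord_dv hK, baryCoord_dv hK,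
        F.β_edge p hp, F.β_edge q hq, F.β_cv K hK]
      simp

/-! ### The divergence of finite element velocities -/

lemma velocity_eventuallyEq {v : E3 → E3} {g : Fin 3 → MvPolynomial (Fin 3) ℝ}
    (hg : ∀ i, ∀ x ∈ convexHull ℝ (K : Set E3), v x i = MvPolynomial.eval (fun i => x i) (g i))
    {x : E3} (hx : x ∈ interior (convexHull ℝ (K : Set E3))) (i : Fin 3) :
    (fun y => v y i) =ᶠ[nhds x] fun y => MvPolynomial.eval (fun i => y i) (g i) := by
  filter_upwards [mem_interior_iff_mem_nhds.1 hx] with y hy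
  exact hg i y hy

lemma velocity_differentiableAt {v : E3 → E3} {g : Fin 3 → MvPolynomial (Fin 3) ℝ}
    (hg : ∀ i, ∀ x ∈ convexHull ℝ (K : Set E3), v x i = MvPolynomial.eval (fun i => x i) (g i))
    {x : E3} (hx : x ∈ interior (convexHull ℝ (K : Set E3))) : DifferentiableAt ℝ v x := by
  rw [differentiableAt_euclidean]
  exact fun i => (differentiable_mvPolynomial_eval (g i) x).congr_of_eventuallyEq
    (velocity_eventuallyEq hg hx i)

lemma fderiv_velocity_apply {v : E3 → E3} {x : E3} (hv : DifferentiableAt ℝ v x) (i : Fin 3)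
    (w : E3) : (fderiv ℝ v x w) i = fderiv ℝ (fun y => v y i) x w := by
  have := ((EuclideanSpace.proj i : E3 →L[ℝ] ℝ).hasFDerivAt (x := v x)).comp x hv.hasFDerivAt
  have h : fderiv ℝ (fun y => v y i) x = (EuclideanSpace.proj i : E3 →L[ℝ] ℝ).comp (fderiv ℝ v x) :=
    this.fderiv
  rw [h]
  rfl

lemma divergence_eq {v : E3 → E3} {g : Fin 3 → MvPolynomial (Fin 3) ℝ}
    (hg : ∀ i, ∀ x ∈ convexHull ℝ (K : Set E3), v x i = MvPolynomial.eval (fun i => x i) (g i))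
    {x : E3} (hx : x ∈ interior (convexHull ℝ (K : Set E3))) :
    divergence v x = ∑ i, MvPolynomial.eval (fun i => x i) (MvPolynomial.pderiv i (g i)) := by
  refine Finset.sum_congr rfl fun i _ => ?_
  rw [partialDeriv, fderiv_velocity_apply (velocity_differentiableAt hg hx),
    (velocity_eventuallyEq hg hx i).fderiv_eq, ← polyGrad_single]
  rfl

lemma isPolyFn_divergence {k : ℕ} {g : Fin 3 → MvPolynomial (Fin 3) ℝ}
    (hg : ∀ i, (g i).totalDegree ≤ k) : IsPolyFn (k - 1) fun x =>
      ∑ i, MvPolynomial.eval (fun i => x i) (MvPolynomial.pderiv i (g i)) :=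
  IsPolyFn.sum _ fun i _ => ⟨_, totalDegree_pderiv_le (g i) i (hg i), fun _ => rfl⟩

/-! ### Integrals over the domain of functions supported in one tetrahedron -/

lemma measurableSet_convexHull_finset (K : Finset E3) :
    MeasurableSet (convexHull ℝ (K : Set E3)) :=
  (isCompact_convexHull_finset K).isClosed.measurableSet

/-- The divergence is controlled only inside tetrahedra; their frontiers are null sets by convexity.
-/
lemma indicator_mul_ae_eq {f g h : E3 → ℝ}
    (hgh : ∀ x ∈ interior (convexHull ℝ (K : Set E3)), h x = g x) :
    (fun x => (convexHull ℝ (K : Set E3)).indicator f x * h x) =ᵐ[volume]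
      (interior (convexHull ℝ (K : Set E3))).indicator fun x => f x * g x := by
  have h1 : ∀ᵐ x, x ∈ interior (convexHull ℝ (K : Set E3)) ↔ x ∈ convexHull ℝ (K : Set E3) :=
    (interior_ae_eq_convexHull K).mem_iff
  filter_upwards [h1] with x hx
  by_cases hxi : x ∈ interior (convexHull ℝ (K : Set E3))
  · rw [Set.indicator_of_mem (hx.1 hxi), Set.indicator_of_mem hxi, hgh x hxi]
  · rw [Set.indicator_of_notMem (mt hx.2 hxi), Set.indicator_of_notMem hxi, zero_mul]

lemma integrable_indicator_mul {f g h : E3 → ℝ} (hf : Continuous f)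
    (hg : Continuous g) (hgh : ∀ x ∈ interior (convexHull ℝ (K : Set E3)), h x = g x) :
    Integrable fun x => (convexHull ℝ (K : Set E3)).indicator f x * h x := by
  refine Integrable.congr ?_ (indicator_mul_ae_eq hgh).symm
  rw [integrable_indicator_iff isOpen_interior.measurableSet]
  exact ((hf.mul hg).continuousOn.integrableOn_compact (isCompact_convexHull_finset K)).mono_set
    interior_subset

lemma setIntegral_dom_indicator_mul (hK : K ∈ tets T) {f g h : E3 → ℝ}
    (hgh : ∀ x ∈ interior (convexHull ℝ (K : Set E3)), h x = g x) :
    ∫ x in dom T, (convexHull ℝ (K : Set E3)).indicator f x * h x =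
      ∫ x in convexHull ℝ (K : Set E3), f x * g x := by
  rw [integral_congr_ae (ae_restrict_of_ae (indicator_mul_ae_eq hgh)),
    setIntegral_indicator isOpen_interior.measurableSet,
    Set.inter_eq_self_of_subset_right (interior_tet_subset_dom hK),
    setIntegral_congr_set (interior_ae_eq_convexHull K)]

/-! ### The critical functions -/

section Crit

variable {n : ℕ} {K : Fin n → Finset E3} {p : E3}

lemma continuous_jacobiPoly_baryCoord (m : ℕ) (K : Finset E3) (p : E3) :
    Continuous fun x => (jacobiPoly 0 3 m).eval (1 - 2 * baryCoord K p x) := by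
  have := continuous_baryCoord K p
  fun_prop

lemma isPolyFn_jacobiPoly_baryCoord (m : ℕ) (K : Finset E3) (p : E3) :
    IsPolyFn m fun x => (jacobiPoly 0 3 m).eval (1 - 2 * baryCoord K p x) := by
  refine IsPolyFn.comp_polynomial (f := fun x => 1 - 2 * baryCoord K p x) ?_ _
    (natDegree_jacobiPoly_le 0 3 m)
  simpa [sub_eq_add_neg] using
    (IsPolyFn.const 1 1).add ((IsPolyFn.affine (baryCoord K p)).const_mul (-2))

/-- The volume from the point evaluation cancels `1/|Kᵢ|`. The minus sign comes from the exponent `i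
+ 1` in `critPressure`. -/
lemma integral_dom_critPressure_mul (k : ℕ) (hK : ∀ i, K i ∈ tets T) (hp : ∀ i, p ∈ K i)
    {h : E3 → ℝ} {g : Fin n → E3 → ℝ} (hg : ∀ i, IsPolyFn (k - 1) (g i))
    (hgh : ∀ i, ∀ x ∈ interior (convexHull ℝ (K i : Set E3)), h x = g i x) :
    ∫ x in dom T, critPressure k K p x * h x =
      - jacobiMean (k - 1) * ∑ i : Fin n, (-1 : ℝ) ^ (i : ℕ) * g i p := by
  simp_rw [critPressure, Finset.sum_mul, mul_assoc]
  rw [integral_finsetSum]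
  swap
  · intro i _
    exact (integrable_indicator_mul (continuous_jacobiPoly_baryCoord _ _ _) (hg i).continuous
      (hgh i)).integrableOn.const_mul _
  rw [Finset.mul_sum]
  refine Finset.sum_congr rfl fun i _ => ?_
  rw [integral_const_mul, setIntegral_dom_indicator_mul (hK i) (hgh i),
    integral_tet_jacobiPoly (T.indep (hK i).1) (hK i).2 (hp i) (hg i)]
  have := (volume_real_convexHull_pos (T.indep (hK i).1) (hK i).2).ne'
  field_simp
  ring

/-- All barycentric coordinates are positive at an interior point, so every vertex of `K` is one of
`K'`. -/
lemma tet_eq_of_mem_interior_of_mem {K K' : Finset E3} (hK : K ∈ tets T) (hK' : K' ∈ tets T) {x : E3}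
    (hx : x ∈ interior (convexHull ℝ (K : Set E3))) (hx' : x ∈ convexHull ℝ (K' : Set E3)) :
    K = K' := by
  refine Finset.eq_of_subset_of_card_le (fun v hv => ?_) (hK'.2.trans hK.2.symm).le
  exact mem_of_baryCoord_pos hK hK'.1 (interior_subset hx) hx' hv
    ((mem_interior_convexHull_tet_iff (T.indep hK.1) hK.2).1 hx v hv)

lemma critPressure_eq_of_mem_interior [DecidableEq (Finset E3)] (k : ℕ) (hK : ∀ i, K i ∈ tets T)
    {L : Finset E3} (hL : L ∈ tets T) {x : E3} (hx : x ∈ interior (convexHull ℝ (L : Set E3))) :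
    critPressure k K p x = ∑ i : Fin n, if K i = L then
      (-1 : ℝ) ^ ((i : ℕ) + 1) / volume.real (convexHull ℝ (K i : Set E3)) *
        (jacobiPoly 0 3 (k - 1)).eval (1 - 2 * baryCoord (K i) p x) else 0 := by
  refine Finset.sum_congr rfl fun i _ => ?_
  split_ifs with h
  · rw [Set.indicator_of_mem (h ▸ interior_subset hx)]
  · rw [Set.indicator_of_notMem, mul_zero]
    exact fun hx' => h (tet_eq_of_mem_interior_of_mem hL (hK i) hx hx').symm

lemma isBounded_dom (hT : IsTetMesh T) : Bornology.IsBounded (dom T) := by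
  refine Bornology.IsBounded.subset ?_ interior_subset
  rw [Bornology.isBounded_biUnion hT.finite_tets]
  exact fun K _ => (isCompact_convexHull_finset K).isBounded

lemma volume_dom_lt_top (hT : IsTetMesh T) : volume (dom T) < ⊤ := (isBounded_dom hT).measure_lt_top

lemma critPressure_mem_pressureSpace (hT : IsTetMesh T) (k : ℕ) (hK : ∀ i, K i ∈ tets T) :
    critPressure k K p ∈ pressureSpace T (k - 1) := by
  classical
  have : IsFiniteMeasure (volume.restrict (dom T)) := isFiniteMeasure_restrict.2 (volume_dom_lt_top hT).ne
  refine ⟨?_, fun L hL => ?_⟩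
  · refine memLp_finsetSum _ fun i _ => MemLp.const_mul ?_ _
    have hc := continuous_jacobiPoly_baryCoord (k - 1) (K i) p
    obtain ⟨C, hC⟩ := (isCompact_convexHull_finset (K i)).exists_bound_of_continuousOn
      hc.continuousOn
    refine MemLp.of_bound ((hc.measurable.indicator
      (measurableSet_convexHull_finset (K i))).aestronglyMeasurable) (max C 0)
      (Filter.Eventually.of_forall fun x => ?_)
    by_cases hx : x ∈ convexHull ℝ (K i : Set E3)
    · rw [Set.indicator_of_mem hx]
      exact (hC x hx).trans (le_max_left _ _)
    · rw [Set.indicator_of_notMem hx]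
      simp
  · have hpoly : IsPolyFn (k - 1) fun x => ∑ i : Fin n, if K i = L then
        (-1 : ℝ) ^ ((i : ℕ) + 1) / volume.real (convexHull ℝ (K i : Set E3)) *
          (jacobiPoly 0 3 (k - 1)).eval (1 - 2 * baryCoord (K i) p x) else 0 := by
      refine IsPolyFn.sum _ fun i _ => ?_
      split_ifs
      · exact (isPolyFn_jacobiPoly_baryCoord _ _ _).const_mul _
      · exact IsPolyFn.const _ 0
    obtain ⟨q, hq, hqe⟩ := hpoly
    refine ⟨q, hq, (ae_restrict_iff' isOpen_interior.measurableSet).2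
      (Filter.Eventually.of_forall fun x hx => ?_)⟩
    exact (critPressure_eq_of_mem_interior k hK hL hx).trans (hqe x)

lemma bForm_critPressure_eq_zero (F : EdgeFrame T E) (k : ℕ) (hK : IsPatchNumbering T E K)
    (hp : p ∈ E) {v : E3 → E3} (hv : v ∈ velocitySpace T k) : bForm T (critPressure k K p) v = 0 := by
  classical
  have hKt : ∀ i, K i ∈ edgePatch T E := EdgeFrame.mem_edgePatch_numbering hK
  obtain ⟨q, hne, hpq⟩ : ∃ q, p ≠ q ∧ E = {p, q} := by
    obtain ⟨a, b, hab, h⟩ := F.exists_edge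
    rw [h, Finset.mem_insert, Finset.mem_singleton] at hp
    rcases hp with rfl | rfl
    · exact ⟨b, hab, h⟩
    · exact ⟨a, hab.symm, by rw [h, Finset.pair_comm]⟩
  have hv2 : ∀ i : Fin 3, ∀ K ∈ tets T, ∃ q : MvPolynomial (Fin 3) ℝ, q.totalDegree ≤ k ∧
      ∀ x ∈ convexHull ℝ (K : Set E3), v x i = MvPolynomial.eval (fun i => x i) q :=
    fun i => (hv i).2.1
  choose! g hdeg hg using hv2
  rw [bForm, integral_dom_critPressure_mul k (fun i => (hKt i).1) (fun i => (hKt i).2 hp)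
    (fun i => isPolyFn_divergence (g := fun j => g j (K i)) fun j => hdeg j _ (hKt i).1)
    fun i x hx => divergence_eq (fun j => hg j _ (hKt i).1) hx]
  -- The alternating sum of the gradients of the `j`-th component vanishes; the divergence needs
  -- only its value on the `j`-th unit vector.
  have h0 : ∀ j, ∑ i : Fin n, (-1 : ℝ) ^ (i : ℕ) *
      MvPolynomial.eval (fun i => p i) (MvPolynomial.pderiv j (g j (K i))) = 0 := by
    intro j
    have h1 := (F.compatible_polyGrad hne hpq (hv j) (hg j)).alternating_sum_eq_zero
      (F.swap.compatible_polyGrad hne hpq (hv j) (hg j)) hK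
    have h2 := congrArg (fun f => f (EuclideanSpace.single j 1)) h1
    simpa only [LinearMap.sum_apply, LinearMap.smul_apply, polyGrad_single, smul_eq_mul,
      LinearMap.zero_apply] using h2
  simp_rw [Finset.mul_sum]
  rw [Finset.sum_comm]
  simp_rw [← Finset.mul_sum]
  simp [h0]

lemma integral_critPressure (k : ℕ) (hK : ∀ i, K i ∈ tets T) (hp : ∀ i, p ∈ K i) :
    ∫ x in dom T, critPressure k K p x = - jacobiMean (k - 1) * ∑ i : Fin n, (-1 : ℝ) ^ (i : ℕ) := by
  simpa using integral_dom_critPressure_mul (T := T) k hK hp (h := fun _ => 1) (g := fun _ _ => 1)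
    (fun _ => IsPolyFn.const _ 1) fun _ _ _ => rfl

/-- If a critical function is almost everywhere equal to the constant `c`, then it is equal to `c`
on each tetrahedron of the patch. -/
lemma eq_const_of_critPressure_ae_eq (k : ℕ) (hK : ∀ i, K i ∈ tets T)
    (hinj : Function.Injective K) {c : ℝ}
    (hc : critPressure k K p =ᵐ[volume.restrict (dom T)] fun _ => c) (i : Fin n) {x : E3}
    (hx : x ∈ convexHull ℝ (K i : Set E3)) :
    (-1 : ℝ) ^ ((i : ℕ) + 1) / volume.real (convexHull ℝ (K i : Set E3)) *
      (jacobiPoly 0 3 (k - 1)).eval (1 - 2 * baryCoord (K i) p x) = c := by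
  classical
  have hcont : Continuous fun x => (-1 : ℝ) ^ ((i : ℕ) + 1) /
      volume.real (convexHull ℝ (K i : Set E3)) *
      (jacobiPoly 0 3 (k - 1)).eval (1 - 2 * baryCoord (K i) p x) :=
    (continuous_jacobiPoly_baryCoord _ _ _).const_mul _
  have h1 : (fun x => (-1 : ℝ) ^ ((i : ℕ) + 1) / volume.real (convexHull ℝ (K i : Set E3)) *
      (jacobiPoly 0 3 (k - 1)).eval (1 - 2 * baryCoord (K i) p x))
      =ᵐ[volume.restrict (interior (convexHull ℝ (K i : Set E3)))] fun _ => c := by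
    have h2 := ae_restrict_of_ae_restrict_of_subset (interior_tet_subset_dom (hK i)) hc
    filter_upwards [h2, ae_restrict_mem isOpen_interior.measurableSet] with y hy hyi
    rw [← hy, critPressure_eq_of_mem_interior k hK (hK i) hyi]
    simp [hinj.eq_iff]
  have h2 := Measure.eqOn_open_of_ae_eq h1 isOpen_interior hcont.continuousOn
    continuous_const.continuousOn
  have h3 := h2.closure hcont continuous_const
  rw [(convex_convexHull ℝ _).closure_interior_eq_closure_of_nonempty_interior
    (interior_convexHull_tet_nonempty (T.indep (hK i).1) (hK i).2)] at h3
  exact h3 (subset_closure hx)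

/-- Evaluate at a vertex other than `p`: the Jacobi polynomial has argument `1` and value `1` there.
-/
lemma const_eq_of_critPressure_ae_eq (k : ℕ) (hK : ∀ i, K i ∈ tets T)
    (hinj : Function.Injective K) (hp : ∀ i, p ∈ K i) {c : ℝ}
    (hc : critPressure k K p =ᵐ[volume.restrict (dom T)] fun _ => c) (i : Fin n) :
    (-1 : ℝ) ^ ((i : ℕ) + 1) / volume.real (convexHull ℝ (K i : Set E3)) = c := by
  classical
  obtain ⟨v, hv, hvp⟩ : ∃ v ∈ K i, v ≠ p :=
    Finset.exists_mem_ne (by rw [(hK i).2]; norm_num) p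
  have := eq_const_of_critPressure_ae_eq k hK hinj hc i (subset_convexHull ℝ _ hv)
  rwa [(baryCoord_spec (T.indep (hK i).1) (hK i).2 (hp i)).2 v hv hvp, mul_zero, sub_zero,
    jacobiPoly_zero_eval_one, mul_one] at this

lemma not_critPressure_ae_eq_zero (k : ℕ) (hK : ∀ i, K i ∈ tets T)
    (hinj : Function.Injective K) (hp : ∀ i, p ∈ K i) (hn : 1 ≤ n) :
    ¬ critPressure k K p =ᵐ[volume.restrict (dom T)] 0 := by
  intro h
  have h1 := const_eq_of_critPressure_ae_eq k hK hinj hp (c := 0) h ⟨0, hn⟩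
  have := volume_real_convexHull_pos (T.indep (hK ⟨0, hn⟩).1) (hK ⟨0, hn⟩).2
  rw [div_eq_zero_iff] at h1
  rcases h1 with h1 | h1
  · simp at h1
  · exact this.ne' h1

/-- A critical function is not constant, unless `k = 1` and the mesh is a single tetrahedron. -/
lemma not_critPressure_ae_eq_const (k : ℕ) (hK : IsPatchNumbering T E K) (hp : p ∈ E)
    (hn : 1 ≤ n) (hk : 2 ≤ k ∨ 2 ≤ (tets T).ncard) (c : ℝ) :
    ¬ critPressure k K p =ᵐ[volume.restrict (dom T)] fun _ => c := by
  classical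
  intro hc
  have hKt : ∀ i, K i ∈ edgePatch T E := EdgeFrame.mem_edgePatch_numbering hK
  have hK' : ∀ i, K i ∈ tets T := fun i => (hKt i).1
  have hpK : ∀ i, p ∈ K i := fun i => (hKt i).2 hp
  have hvol := fun i => volume_real_convexHull_pos (T.indep (hK' i).1) (hK' i).2
  have h1 := const_eq_of_critPressure_ae_eq k hK' hK.injective hpK hc
  have hneg : c < 0 := by
    rw [← h1 ⟨0, hn⟩]
    have := hvol ⟨0, hn⟩
    simp only [zero_add, pow_one]
    exact div_neg_of_neg_of_pos (by norm_num) this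
  rcases hk with hk | hk
  -- For `k ≥ 2` the Jacobi polynomial would be `1` on `[-1, 1]`, as seen along the segment from `p`
  -- to another vertex. This contradicts its orthogonality to constants with weight `r^3`.
  · set i : Fin n := ⟨0, hn⟩
    obtain ⟨v, hv, hvp⟩ : ∃ v ∈ K i, v ≠ p :=
      Finset.exists_mem_ne (by rw [(hK' i).2]; norm_num) p
    obtain ⟨b1, b0⟩ := baryCoord_spec (T.indep (hK' i).1) (hK' i).2 (hpK i)
    have hone : ∀ r ∈ Set.uIcc (0 : ℝ) 1,
        (jacobiPoly 0 3 (k - 1)).eval (2 * r - 1) * r ^ (0 + 3) = r ^ 3 := by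
      intro r hr
      rw [Set.uIcc_of_le zero_le_one] at hr
      have hx : (1 - r) • p + r • v ∈ convexHull ℝ (K i : Set E3) :=
        (convex_convexHull ℝ _) (subset_convexHull ℝ _ (hpK i)) (subset_convexHull ℝ _ hv)
          (by linarith [hr.2]) hr.1 (by ring)
      have h2 := eq_const_of_critPressure_ae_eq k hK' hK.injective hc i hx
      rw [h1 i, Convex.combo_affine_apply (by ring), b1, b0 v hv hvp] at h2
      have h3 := mul_left_cancel₀ hneg.ne (h2.trans (mul_one c).symm)
      rw [show 1 - 2 * ((1 - r) • (1 : ℝ) + r • (0 : ℝ)) = 2 * r - 1 by simp; ring] at h3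
      rw [h3]; ring
    have h4 := integral_jacobiPoly_mul_pow (k - 1) 0 (by omega)
    rw [intervalIntegral.integral_congr hone, integral_pow] at h4
    norm_num at h4
  -- Two tetrahedra in the patch force opposite signs of `c`; with only one, some tetrahedron
  -- outside the patch forces `c = 0`.
  · rcases Nat.lt_or_ge 1 n with h2n | h2n
    · have h2 := h1 ⟨1, h2n⟩
      have : 0 < c := by
        rw [← h2]
        have := hvol ⟨1, h2n⟩
        simp only [Nat.reduceAdd, even_two, Even.neg_pow, one_pow]
        positivity
      exact lt_asymm hneg this
    · obtain rfl : n = 1 := by omega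
      have : ∃ L ∈ tets T, L ≠ K 0 := Set.exists_ne_of_one_lt_ncard (by omega) (K 0)
      obtain ⟨L, hL, hLK⟩ := this
      have h2 := ae_restrict_of_ae_restrict_of_subset (interior_tet_subset_dom hL) hc
      have h3 : ∀ᵐ x ∂volume.restrict (interior (convexHull ℝ (L : Set E3))), False := by
        filter_upwards [h2, ae_restrict_mem isOpen_interior.measurableSet] with x hx hxi
        rw [critPressure_eq_of_mem_interior k hK' hL hxi] at hx
        simp [hLK.symm] at hx
        exact hneg.ne hx.symm
      rw [Filter.eventually_false_iff_eq_bot, ae_eq_bot, Measure.restrict_eq_zero] at h3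
      exact (isOpen_interior.measure_pos volume
        (interior_convexHull_tet_nonempty (T.indep hL.1) hL.2)).ne' h3

end Crit

/-! ### Lipschitz continuity of finite element functions -/

/-- Along the segment from `x` to `y` it suffices to bound right difference quotients for
arbitrarily small increments; a global bound then follows by comparison with a linear function. -/
lemma le_of_closed_cover_lipschitzOnWith {V ι : Type*} [NormedAddCommGroup V] [NormedSpace ℝ V]
    [Finite ι] {S : ι → Set V} (hS : ∀ i, IsClosed (S i)) (hcov : ∀ x, ∃ i, x ∈ S i) {f : V → ℝ}
    (hf : Continuous f) {L : NNReal} (hL : ∀ i, LipschitzOnWith L f (S i)) (x y : V) :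
    f y ≤ f x + L * ‖y - x‖ := by
  set γ : ℝ → V := fun t => x + t • (y - x) with hγ
  have hγc : Continuous γ := by fun_prop
  have main := image_le_of_liminf_slope_right_le_deriv_boundary (f := fun t => f (γ t)) (a := 0)
    (b := 1) (B := fun t => f x + L * ‖y - x‖ * t) (B' := fun _ => L * ‖y - x‖)
    (hf.comp hγc).continuousOn (by simp [hγ]) (by fun_prop)
    (fun t _ => by
      simpa using (((hasDerivAt_id t).const_mul (L * ‖y - x‖)).const_add (f x)).hasDerivWithinAt)
    (fun t _ r hr => by
      -- By finiteness one set of the cover is met arbitrarily close to the right of `t`; being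
      -- closed, it contains `γ t` as well.
      have : ∃ i, ∃ᶠ z in nhdsWithin t (Set.Ioi t), γ z ∈ S i := by
        by_contra hcon
        simp only [not_exists, Filter.not_frequently] at hcon
        obtain ⟨z, hz⟩ := (Filter.eventually_all.2 hcon).exists
        obtain ⟨i, hi⟩ := hcov (γ z)
        exact hz i hi
      obtain ⟨i, hi⟩ := this
      have hti : γ t ∈ S i := by
        by_contra hti
        have h1 : ∀ᶠ z in nhds t, γ z ∈ (S i)ᶜ :=
          hγc.continuousAt.eventually ((hS i).isOpen_compl.mem_nhds hti)
        exact hi (h1.filter_mono nhdsWithin_le_nhds)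
      refine (hi.and_eventually self_mem_nhdsWithin).mono ?_
      rintro z ⟨hz, htz⟩
      have htz : t < z := htz
      have h1 := (hL i).dist_le_mul _ hz _ hti
      have h2 : dist (γ z) (γ t) = (z - t) * ‖y - x‖ := by
        rw [dist_eq_norm, hγ]
        simp only [add_sub_add_left_eq_sub]
        rw [← sub_smul, norm_smul, Real.norm_of_nonneg (by linarith)]
      rw [h2, Real.dist_eq] at h1
      rw [slope_def_field]
      refine lt_of_le_of_lt ?_ hr
      rw [div_le_iff₀ (by linarith)]
      calc f (γ z) - f (γ t) ≤ |f (γ z) - f (γ t)| := le_abs_self _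
        _ ≤ _ := h1
        _ = _ := by ring)
  have := main (x := 1) (by simp)
  simpa [hγ] using this

lemma lipschitzWith_of_closed_cover {V ι : Type*} [NormedAddCommGroup V] [NormedSpace ℝ V]
    [Finite ι] {S : ι → Set V} (hS : ∀ i, IsClosed (S i)) (hcov : ∀ x, ∃ i, x ∈ S i) {f : V → ℝ}
    {L : NNReal} (hL : ∀ i, LipschitzOnWith L f (S i)) : LipschitzWith L f := by
  have hf : Continuous f := (locallyFinite_of_finite S).continuous
    (Set.iUnion_eq_univ_iff.2 hcov) hS fun i => (hL i).continuousOn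
  refine LipschitzWith.of_dist_le_mul fun x y => ?_
  rw [Real.dist_eq, abs_sub_le_iff, dist_eq_norm]
  constructor
  · linarith [le_of_closed_cover_lipschitzOnWith hS hcov hf hL y x]
  · have := le_of_closed_cover_lipschitzOnWith hS hcov hf hL x y
    rw [norm_sub_rev] at this
    linarith

lemma exists_lipschitzOnWith_mvPolynomial_eval (q : MvPolynomial (Fin 3) ℝ) (K : Finset E3) :
    ∃ L : NNReal, LipschitzOnWith L (fun y : E3 => MvPolynomial.eval (fun i => y i) q)
      (convexHull ℝ (K : Set E3)) := by
  have hc : Continuous fun x : E3 => ∑ i, MvPolynomial.eval (fun i => x i)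
      (MvPolynomial.pderiv i q) • (EuclideanSpace.proj i : E3 →L[ℝ] ℝ) :=
    continuous_finsetSum _ fun i _ => Continuous.smul
      (IsPolyFn.continuous (m := _) ⟨_, le_rfl, fun _ => rfl⟩) continuous_const
  obtain ⟨C, hC⟩ := (isCompact_convexHull_finset K).exists_bound_of_continuousOn hc.continuousOn
  refine ⟨C.toNNReal, (convex_convexHull ℝ _).lipschitzOnWith_of_nnnorm_hasFDerivWithin_le
    (fun x _ => (hasFDerivAt_mvPolynomial_eval q x).hasFDerivWithinAt) fun x hx => ?_⟩
  rw [← NNReal.coe_le_coe, coe_nnnorm]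
  exact (hC x hx).trans (Real.le_coe_toNNReal C)

/-- The closed tetrahedra, with polynomials on them, and the complement of the domain, where `u =
0`, form a finite closed cover of space. -/
lemma exists_lipschitzWith_of_mem_scalarSpace (hT : IsTetMesh T) {k : ℕ} {u : E3 → ℝ}
    (hu : u ∈ scalarSpace T k) : ∃ L : NNReal, LipschitzWith L u := by
  classical
  obtain ⟨-, hu1, hu0⟩ := hu
  have : Finite (tets T) := hT.finite_tets
  have := Fintype.ofFinite (tets T)
  have hL : ∀ K : tets T, ∃ L : NNReal, LipschitzOnWith L u (convexHull ℝ (K.1 : Set E3)) := by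
    intro K
    obtain ⟨q, -, hq⟩ := hu1 K.1 K.2
    obtain ⟨L, hL⟩ := exists_lipschitzOnWith_mvPolynomial_eval q K.1
    refine ⟨L, fun x hx y hy => ?_⟩
    rw [hq x hx, hq y hy]
    exact hL hx hy
  choose L hL using hL
  refine ⟨∑ K, L K, lipschitzWith_of_closed_cover (ι := Option (tets T))
    (S := fun o => o.elim (dom T)ᶜ fun K => convexHull ℝ (K.1 : Set E3)) ?_ ?_ ?_⟩
  · rintro (_ | K)
    · exact (isOpen_dom T).isClosed_compl
    · exact (isCompact_convexHull_finset K.1).isClosed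
  · intro x
    by_cases hx : x ∈ dom T
    · obtain ⟨K, hK, hxK⟩ := Set.mem_iUnion₂.1 (interior_subset hx)
      exact ⟨some ⟨K, hK⟩, hxK⟩
    · exact ⟨none, hx⟩
  · rintro (_ | K)
    · intro x hx y hy
      rw [hu0 x hx, hu0 y hy]
      simp
    · exact (hL K).weaken (Finset.single_le_sum (f := L) (fun _ _ => zero_le) (Finset.mem_univ K))

lemma isCompact_iUnion_tets (hT : IsTetMesh T) :
    IsCompact (⋃ K ∈ tets T, convexHull ℝ (K : Set E3)) :=
  hT.finite_tets.isCompact_biUnion fun K _ => isCompact_convexHull_finset K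

lemma hasCompactSupport_of_mem_scalarSpace (hT : IsTetMesh T) {k : ℕ} {u : E3 → ℝ}
    (hu : u ∈ scalarSpace T k) : HasCompactSupport u :=
  HasCompactSupport.intro (isCompact_iUnion_tets hT) fun x hx =>
    hu.2.2 x fun h => hx (interior_subset h)

lemma ae_mem_interior_of_mem_tet (hT : IsTetMesh T) : ∀ᵐ x : E3, ∀ K ∈ tets T,
    x ∈ convexHull ℝ (K : Set E3) → x ∈ interior (convexHull ℝ (K : Set E3)) := by
  rw [ae_ball_iff hT.finite_tets.countable]
  intro K _
  filter_upwards [(interior_ae_eq_convexHull K).mem_iff] with x hx using hx.2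

/-- Integration by parts of a compactly supported Lipschitz function against the constant `1`.
Almost every point outside the domain has a neighbourhood on which `u` vanishes. -/
lemma integral_dom_lineDeriv_eq_zero (hT : IsTetMesh T) {k : ℕ} {u : E3 → ℝ}
    (hu : u ∈ scalarSpace T k) (w : E3) : ∫ x in dom T, lineDeriv ℝ u x w = 0 := by
  obtain ⟨L, hL⟩ := exists_lipschitzWith_of_mem_scalarSpace hT hu
  have h1 := (LipschitzWith.const (1 : ℝ)).integral_lineDeriv_mul_eq (μ := (volume : Measure E3))
    hL (hasCompactSupport_of_mem_scalarSpace hT hu) (-w)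
  have h0 : ∀ (c : ℝ) (x w : E3), lineDeriv ℝ (fun _ : E3 => c) x w = 0 := fun c x w => by
    simp [lineDeriv]
  simp only [h0, zero_mul, integral_zero, neg_neg, mul_one] at h1
  rw [h1]
  refine setIntegral_eq_integral_of_ae_compl_eq_zero ?_
  filter_upwards [ae_mem_interior_of_mem_tet hT] with x hx hxd
  have hx' : x ∈ (⋃ K ∈ tets T, convexHull ℝ (K : Set E3))ᶜ := by
    intro h
    obtain ⟨K, hK, hxK⟩ := Set.mem_iUnion₂.1 h
    exact hxd (interior_tet_subset_dom hK (hx K hK hxK))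
  have he : u =ᶠ[nhds x] fun _ => 0 := by
    filter_upwards [(isCompact_iUnion_tets hT).isClosed.isOpen_compl.mem_nhds hx'] with y hy
    exact hu.2.2 y fun h => hy (interior_subset h)
  rw [he.lineDeriv_eq, h0]

lemma divergence_ae_eq (hT : IsTetMesh T) {k : ℕ} {v : E3 → E3} (hv : v ∈ velocitySpace T k) :
    divergence v =ᵐ[volume.restrict (dom T)]
      fun x => ∑ i, lineDeriv ℝ (fun y => v y i) x (EuclideanSpace.single i 1) := by
  have hv2 : ∀ i : Fin 3, ∀ K ∈ tets T, ∃ q : MvPolynomial (Fin 3) ℝ, q.totalDegree ≤ k ∧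
      ∀ x ∈ convexHull ℝ (K : Set E3), v x i = MvPolynomial.eval (fun i => x i) q :=
    fun i => (hv i).2.1
  choose! g hdeg hg using hv2
  filter_upwards [ae_restrict_of_ae (ae_mem_interior_of_mem_tet hT),
    ae_restrict_mem (isOpen_dom T).measurableSet] with x hx hxd
  obtain ⟨K, hK, hxK⟩ := Set.mem_iUnion₂.1 (interior_subset hxd)
  have hd := velocity_differentiableAt (fun j => hg j K hK) (hx K hK hxK)
  refine Finset.sum_congr rfl fun i _ => ?_
  rw [partialDeriv, fderiv_velocity_apply hd, DifferentiableAt.lineDeriv_eq_fderiv]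
  exact differentiableAt_euclidean.1 hd i

lemma memLp_divergence (hT : IsTetMesh T) {k : ℕ} {v : E3 → E3} (hv : v ∈ velocitySpace T k) :
    MemLp (divergence v) 2 (volume.restrict (dom T)) := by
  have : IsFiniteMeasure (volume.restrict (dom T)) := isFiniteMeasure_restrict.2 (volume_dom_lt_top hT).ne
  refine (memLp_congr_ae (divergence_ae_eq hT hv)).2 (memLp_finsetSum _ fun i _ => ?_)
  obtain ⟨L, hL⟩ := exists_lipschitzWith_of_mem_scalarSpace hT (hv i)
  exact (hL.memLp_lineDeriv _).mono_exponent le_top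

lemma integral_dom_divergence_eq_zero (hT : IsTetMesh T) {k : ℕ} {v : E3 → E3}
    (hv : v ∈ velocitySpace T k) : ∫ x in dom T, divergence v x = 0 := by
  have : IsFiniteMeasure (volume.restrict (dom T)) := isFiniteMeasure_restrict.2 (volume_dom_lt_top hT).ne
  rw [integral_congr_ae (divergence_ae_eq hT hv), integral_finsetSum]
  · exact Finset.sum_eq_zero fun i _ => integral_dom_lineDeriv_eq_zero hT (hv i) _
  · intro i _
    obtain ⟨L, hL⟩ := exists_lipschitzWith_of_mem_scalarSpace hT (hv i)
    exact (hL.memLp_lineDeriv _).integrable le_top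

/-! ### Instability -/

/-- For such a `p` all quotients are zero, so the supremum is at most `0`, also if there is no
non-zero velocity. -/
lemma not_infSupStable_of_orthogonal {V : Set (E3 → E3)} {M : Set (E3 → ℝ)} {p : E3 → ℝ}
    (hp : p ∈ M) (hp0 : ¬ p =ᵐ[volume.restrict (dom T)] 0) (hb : ∀ v ∈ V, bForm T p v = 0) :
    ¬ InfSupStable T V M := by
  rintro ⟨γ, hγ, h⟩
  have h1 := h.trans (iInf₂_le p ⟨hp, hp0⟩)
  have h2 : (⨆ v ∈ {v | v ∈ V ∧ v ≠ 0},
      ((bForm T p v / (velocityNorm T v * l2Norm T p) : ℝ) : EReal)) ≤ 0 := by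
    refine iSup₂_le fun v hv => ?_
    rw [hb v hv.1, zero_div, EReal.coe_zero]
  exact absurd (h1.trans h2) (not_le.2 (by exact_mod_cast hγ))

/-- An orthogonal pressure that is not constant leads, after subtraction of its mean, to an
orthogonal pressure of mean zero. -/
lemma not_infSupStable_of_not_const (hT : IsTetMesh T) (hne : (tets T).Nonempty) {k m : ℕ}
    {p : E3 → ℝ} (hp : p ∈ pressureSpace T m)
    (hc : ∀ c : ℝ, ¬ p =ᵐ[volume.restrict (dom T)] fun _ => c)
    (hb : ∀ v ∈ velocitySpace T k, bForm T p v = 0) :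
    ¬ InfSupStable T (velocitySpace T k) (pressureSpaceZero T m) := by
  have : IsFiniteMeasure (volume.restrict (dom T)) := isFiniteMeasure_restrict.2 (volume_dom_lt_top hT).ne
  have hvol : volume.real (dom T) ≠ 0 := by
    obtain ⟨K, hK⟩ := hne
    have h1 := interior_convexHull_tet_nonempty (T.indep hK.1) hK.2
    exact (ENNReal.toReal_pos ((isOpen_dom T).measure_pos volume
      (h1.mono (interior_tet_subset_dom hK))).ne' (volume_dom_lt_top hT).ne).ne'
  have hpi : Integrable p (volume.restrict (dom T)) := hp.1.integrable one_le_two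
  set c : ℝ := (∫ x in dom T, p x) / volume.real (dom T) with hcdef
  refine not_infSupStable_of_orthogonal (p := fun x => p x - c) ⟨⟨?_, fun K hK => ?_⟩, ?_⟩ ?_ ?_
  · exact hp.1.sub (memLp_const c)
  · obtain ⟨q, hq, hpq⟩ := hp.2 K hK
    refine ⟨q - MvPolynomial.C c, (MvPolynomial.totalDegree_sub_C_le q c).trans hq, ?_⟩
    filter_upwards [hpq] with x hx
    simp [hx]
  · rw [integral_sub hpi (integrable_const c)]
    simp only [integral_const, smul_eq_mul, measureReal_restrict_apply_univ, hcdef]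
    field_simp
    ring
  · intro h
    refine hc c ?_
    filter_upwards [h] with x hx
    exact sub_eq_zero.1 hx
  · intro v hv
    have hd := memLp_divergence hT hv
    have h1 : Integrable (fun x => p x * divergence v x) (volume.restrict (dom T)) :=
      hp.1.integrable_mul hd
    have h2 : Integrable (fun x => c * divergence v x) (volume.restrict (dom T)) :=
      (hd.integrable one_le_two).const_mul c
    have h3 := hb v hv
    rw [bForm] at h3 ⊢
    simp_rw [sub_mul]
    rw [integral_sub h1 h2, h3, integral_const_mul, integral_dom_divergence_eq_zero hT hv]
    simp

/-! ### Inner and boundary edges, and the main theorem -/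

lemma EdgeFrame.forall_exists_sgn_of_inner (F : EdgeFrame T E) (hE : E ∈ innerEdges T)
    (s : Bool × Bool) : ∃ K ∈ edgePatch T E, F.sgn K = s := by
  obtain ⟨p, q, hne, hpq⟩ := F.exists_edge
  obtain ⟨m, hm, hmd⟩ := exists_openSegment_mem_dom F.mesh hE hpq
  exact F.exists_sgn_eq_of_mem_dom hpq hne hm hmd s

/-- With all wedges occupied, the midpoint of the edge would be in the open domain and not on its
frontier. -/
lemma EdgeFrame.exists_missing_of_boundary (F : EdgeFrame T E) (hE : E ∈ boundaryEdges T) :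
    ∃ s, ∀ K ∈ edgePatch T E, F.sgn K ≠ s := by
  by_contra! hcon
  obtain ⟨p, q, hne, hpq⟩ := F.exists_edge
  have hm : midpoint ℝ p q ∈ openSegment ℝ p q := midpoint_mem_openSegment p q
  have hd := F.mem_dom_of_forall_sgn hpq hne hm hcon
  have hf : midpoint ℝ p q ∈ frontier (dom T) := by
    refine hE.2 ?_
    rw [hpq, Finset.coe_pair, convexHull_pair]
    exact openSegment_subset_segment _ _ _ hm
  rw [(isOpen_dom T).frontier_eq] at hf
  exact hf.2 hd

lemma numbering_length_unique {n m : ℕ} {K : Fin n → Finset E3} {L : Fin m → Finset E3}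
    (hK : IsPatchNumbering T E K) (hL : IsPatchNumbering T E L) : n = m := by
  have h1 := Set.ncard_range_of_injective hK.injective
  have h2 := Set.ncard_range_of_injective hL.injective
  rw [hK.range_eq] at h1
  rw [hL.range_eq] at h2
  simpa using h1.symm.trans h2

end Mesh

theorem mainTheorem2 (T : Geometry.SimplicialComplex ℝ E3) (hT : IsTetMesh T)
    (k : ℕ) (hk : 1 ≤ k) (E : Finset E3) (hE : IsCriticalEdge T E) :
    (E ∈ innerEdges T →
      ∃ K : Fin 4 → Finset E3, IsPatchNumbering T E K ∧ IsCyclicNumbering T K) ∧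
    (E ∈ boundaryEdges T →
      ∃ n : ℕ, 1 ≤ n ∧ n ≤ 3 ∧ ∃ K : Fin n → Finset E3, IsPatchNumbering T E K) ∧
    (∀ (n : ℕ) (K : Fin n → Finset E3), IsPatchNumbering T E K → ∀ p ∈ E,
      critPressure k K p ∈ pressureSpace T (k - 1) ∧
      (∀ v ∈ velocitySpace T k, bForm T (critPressure k K p) v = 0) ∧
      (E ∈ innerEdges T ∨ n = 2 → IsCriticalPressure T k (critPressure k K p))) ∧
    (E ∈ innerEdges T ∨ 2 ≤ k ∨ 2 ≤ (tets T).ncard →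
      ¬ InfSupStable T (velocitySpace T k) (pressureSpaceZero T (k - 1))) := by
  obtain ⟨F⟩ := exists_edgeFrame hT hE
  have inner : E ∈ innerEdges T →
      ∃ K : Fin 4 → Finset E3, IsPatchNumbering T E K ∧ IsCyclicNumbering T K := fun h =>
    F.exists_cyclicNumbering (F.forall_exists_sgn_of_inner h)
  have boundary : E ∈ boundaryEdges T →
      ∃ n : ℕ, 1 ≤ n ∧ n ≤ 3 ∧ ∃ K : Fin n → Finset E3, IsPatchNumbering T E K := fun h => by
    obtain ⟨s, hs⟩ := F.exists_missing_of_boundary h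
    exact F.exists_numbering_of_missing hs
  refine ⟨inner, boundary, fun n K hK p hp => ?_, fun h => ?_⟩
  · have hKt := fun i => (EdgeFrame.mem_edgePatch_numbering hK i).1
    have hpK := fun i => (EdgeFrame.mem_edgePatch_numbering hK i).2 hp
    have hps := critPressure_mem_pressureSpace (p := p) hT k hKt
    have hb : ∀ v ∈ velocitySpace T k, bForm T (critPressure k K p) v = 0 := fun v hv =>
      bForm_critPressure_eq_zero F k hK hp hv
    refine ⟨hps, hb, fun h => ⟨⟨hps, ?_⟩, not_critPressure_ae_eq_zero k hKt hK.injective hpK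
      (F.one_le_of_numbering hK), hb⟩⟩
    -- The mean is a multiple of the sum of `(-1)^i`, which vanishes because the patch has an even
    -- number of members.
    have hn : n = 4 ∨ n = 2 := h.imp (fun h => by
      obtain ⟨L, hL, -⟩ := inner h
      exact numbering_length_unique hK hL) id
    rw [integral_critPressure k hKt hpK]
    rcases hn with rfl | rfl <;> norm_num [Fin.sum_univ_succ]
  -- An inner edge already provides four tetrahedra, so the exceptional case cannot occur.
  · have hcard : 2 ≤ k ∨ 2 ≤ (tets T).ncard := by
      rcases h with h | h
      · obtain ⟨L, hL, -⟩ := inner h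
        have h1 := Set.ncard_range_of_injective hL.injective
        have h2 : Set.range L ⊆ tets T := by
          rw [hL.range_eq]
          exact fun K hK => hK.1
        have h3 := Set.ncard_le_ncard h2 hT.finite_tets
        rw [h1] at h3
        simp at h3
        omega
      · exact h
    obtain ⟨n, K, hK⟩ : ∃ (n : ℕ) (K : Fin n → Finset E3), IsPatchNumbering T E K := by
      by_cases hb : E ∈ boundaryEdges T
      · obtain ⟨n, -, -, K, hK⟩ := boundary hb
        exact ⟨n, K, hK⟩
      · obtain ⟨K, hK, -⟩ := inner ⟨hE.1, hb⟩
        exact ⟨4, K, hK⟩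
    obtain ⟨p, hp⟩ := T.nonempty_of_mem_faces hE.1.1
    obtain ⟨K₀, hK₀⟩ := edgePatch_nonempty hT hE.1
    exact not_infSupStable_of_not_const hT ⟨K₀, hK₀.1⟩
      (critPressure_mem_pressureSpace hT k fun i => (EdgeFrame.mem_edgePatch_numbering hK i).1)
      (not_critPressure_ae_eq_const k hK hp (F.one_le_of_numbering hK) hcard)
      fun v hv => bForm_critPressure_eq_zero F k hK hp hv
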